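/- Consider the classical risk reserve $U_t=U_t(u)=u+ct-\sum_{i=1}^{N_t}Z_i$, where $u\ge 0$, $c>0$, $(N_t)$ is a Poisson process of intensity $\lambda>0$ and, independently of it, the $Z_i$ are i.i.d. positive random variables with unbounded support and moments $m_i=\mathbb E[Z_1^i]$. Let $\theta=c/(\lambda m_1)-1$ be the safety loading, $f_I(x)=\mathbb P(Z_1>x)/m_1$, $\overline F_I(x)=1-\int_0^x f_I(y)\,dy$, $T=\inf\{t\ge 0: U_t<0\}$ the time of ruin, and $d_j(u)=\mathbb E[\,|U_T|^j \mid T<\infty]$ the conditional $j$-th moment of the deficit at ruin. For an integer $k$, the model satisfies the assumptions of order $k$ if (A1) there is $R>0$ with $\int_0^\infty e^{Rx}\frac{f_I(x)}{1+\theta}\,dx=1$; (A2) $m_k^{\exp}:=\int_0^\infty x^k e^{Rx}\frac{f_I(x)}{1+\theta}\,dx<\infty$; (A3) $h_I:=\sup_{x\ge 0} f_I(x)/\overline F_I(x)<\infty$. A second model $(U_t^{DV})$ of the same kind, with its quantities marked by the superscript $DV$, is an order-$k$ De Vylder type approximation of $(U_t)$ if $\mathbb E[U_t^i(u)]=\mathbb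 E[(U^{DV}_t(u))^i]$ for all $i=1,\dots,k$ and all $t\ge 0$, $u\ge 0$. Let $k\ge 2$ and $1\le j\le k-1$, and suppose that both models satisfy the assumptions of order $k$ and that $(U_t^{DV})$ is an order-$k$ De Vylder type approximation of $(U_t)$. Then for all $u\ge 0$ ruin has positive probability in both models, $d_j(u)$ and $d_j^{DV}(u)$ are finite, $d_j(u)>0$, and $$d_j(u)-d_j^{DV}(u)=O(1),\qquad \frac{d_j(u)-d_j^{DV}(u)}{d_j(u)}=O(1).$$ Here $O(1)$ means bounded in absolute value by a constant $C$ for all $u\ge0$ and all $\theta>0$ in a bounded interval $(0,\theta_{\max}]$, in the following two senses. (a) $C$ depends only on $k$, $j$, $\theta_{\max}$, the moments $m_1,\dots,m_k$ and $m_1^{DV},\dots,m_k^{DV}$, and upper bounds for $m_k^{\exp}$, $m_k^{\exp,DV}$, $h_I$, $h_I^{DV}$. (b) If, for each $\theta\in(0,\theta_{\max}]$, a pair of models as above with safety loading $\theta$ of the first model is given, and the two claim distributions do not depend on $\theta$, then one $C$ works for all $u\ge 0$ and all $\theta\in(0,\theta_{\max}]$. Moreover, at $u=0$ one has $d_j(0)=\frac{m_{j+1}}{(j+1)m_1}$,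 $d_j^{DV}(0)=\frac{m^{DV}_{j+1}}{(j+1)m^{DV}_1}$, and $$\frac{d_j(0)-d_j^{DV}(0)}{d_j(0)}=1-\frac{m_1\,m_2^{DV}}{m_2\,m_1^{DV}},$$ so that at $u=0$ the relative error is a constant determined by the first two claim moments of the two models, not by $\theta$ itself; for fixed claim distributions it does not tend to $0$ as $\theta\to0$ unless it vanishes identically, that is, unless $m_1m_2^{DV}=m_2m_1^{DV}$. -/

import Mathlib

open MeasureTheory ProbabilityTheory Set
open scoped ENNReal NNReal

universe v w

/-- A classical (compound Poisson) risk model: claim inter-arrival times `W i`, i.i.d. exponential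
of rate `lam` (so that the claim counting process is a Poisson process of intensity `lam`),
i.i.d. positive claim costs `Z i` with unbounded support, independent of the arrivals, and a
premium rate `c > 0`. Arrivals and claims are indexed from `0`. -/
structure RiskModel where
  /-- the sample space -/
  Ω : Type v
  [mΩ : MeasurableSpace Ω]
  /-- the probability measure -/
  P : Measure Ω
  [isProb : IsProbabilityMeasure P]
  /-- intensity of the claim arrivals -/
  lam : ℝ
  /-- premium per unit time -/
  c : ℝ
  /-- inter-arrival times -/
  W : ℕ → Ω → ℝ
  /-- claim costs -/
  Z : ℕ → Ω → ℝ
  lam_pos : 0 < lam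
  c_pos : 0 < c
  measurable_W : ∀ i, Measurable (W i)
  measurable_Z : ∀ i, Measurable (Z i)
  law_W : ∀ i, P.map (W i) = expMeasure lam
  Z_pos : ∀ i, ∀ᵐ ω ∂P, 0 < Z i ω
  law_Z : ∀ i, P.map (Z i) = P.map (Z 0)
  indep : iIndepFun (Sum.elim W Z) P
  unbounded_support : ∀ x : ℝ, 0 < P {ω | x < Z 0 ω}

namespace RiskModel

attribute [instance] RiskModel.mΩ RiskModel.isProb

noncomputable section

variable (M : RiskModel.{v})

/-- The common law of the claims. -/
def claimLaw : Measure ℝ := M.P.map (M.Z 0)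

/-- The `j`-th moment `m_j` of the claims. -/
def moment (j : ℕ) : ℝ := ∫ ω, M.Z 0 ω ^ j ∂M.P

/-- The safety loading coefficient `θ = c / (λ m₁) - 1`. -/
def loading : ℝ := M.c / (M.lam * M.moment 1) - 1

/-- The survival function of the claims. -/
def survival (x : ℝ) : ℝ := M.P.real {ω | x < M.Z 0 ω}

/-- The density `f_I` of the integrated tail distribution. -/
def tailDensity (x : ℝ) : ℝ := M.survival x / M.moment 1

/-- The survival function of the integrated tail distribution. -/
def tailSurvival (x : ℝ) : ℝ := 1 - (∫ y in (0 : ℝ)..x, M.survival y) / M.moment 1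

/-- The time of the claim number `n` (counted from `0`). -/
def arrival (n : ℕ) (ω : M.Ω) : ℝ := ∑ i ∈ Finset.range (n + 1), M.W i ω

/-- The Poisson process: number of claims until time `t`. -/
def count (t : ℝ) (ω : M.Ω) : ℕ := {n : ℕ | M.arrival n ω ≤ t}.ncard

/-- The risk reserve `U_t(u)`. -/
def reserve (u t : ℝ) (ω : M.Ω) : ℝ :=
  u + M.c * t - ∑ i ∈ Finset.range (M.count t ω), M.Z i ω

/-- The time of ruin `T(u) = inf {t ≥ 0 : U_t(u) < 0}`, with value `∞` if there is no ruin. -/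
def ruinTime (u : ℝ) (ω : M.Ω) : ℝ≥0∞ :=
  ⨅ t ∈ {t : ℝ | 0 ≤ t ∧ M.reserve u t ω < 0}, ENNReal.ofReal t

/-- The event of ruin, `T(u) < ∞`. -/
def ruin (u : ℝ) : Set M.Ω := {ω | M.ruinTime u ω < ∞}

/-- The deficit at ruin `|U_T|` (meaningful on the event of ruin). -/
def deficit (u : ℝ) (ω : M.Ω) : ℝ := |M.reserve u (M.ruinTime u ω).toReal ω|

/-- The `j`-th moment of the deficit at ruin given that ruin occurs,
`d_j(u) = E[|U_T|^j | T < ∞]`. -/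
def deficitMoment (j : ℕ) (u : ℝ) : ℝ :=
  ∫ ω, M.deficit u ω ^ j ∂(ProbabilityTheory.cond M.P (M.ruin u))

/-- `R` is the adjustment coefficient (Lundberg exponent) of the model. -/
def IsAdjustmentCoeff (R : ℝ) : Prop :=
  0 < R ∧ ∫ x in Ioi (0 : ℝ), Real.exp (R * x) * (M.tailDensity x / (1 + M.loading)) = 1

/-- The exponentially tilted moment `∫ x^k exp(R x) f_I(x) / (1 + θ) dx` in `[0, ∞]`. -/
def expMoment (k : ℕ) (R : ℝ) : ℝ≥0∞ :=
  ∫⁻ x in Ioi (0 : ℝ),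
    ENNReal.ofReal (x ^ k * Real.exp (R * x) * (M.tailDensity x / (1 + M.loading)))

/-- The supremum `h_I` of the hazard rate of the integrated tail distribution, in `[0, ∞]`. -/
def hazardSup : ℝ≥0∞ :=
  ⨆ x ∈ Ici (0 : ℝ), ENNReal.ofReal (M.tailDensity x) / ENNReal.ofReal (M.tailSurvival x)

/-- The Cramér–Lundberg condition with adjustment coefficient `R`, finiteness of the tilted
moment of order `k`, and boundedness of the hazard rate. -/
structure Assumptions (k : ℕ) (R : ℝ) : Prop where
  lundberg : M.IsAdjustmentCoeff R
  expMoment_lt_top : M.expMoment k R < ∞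
  hazardSup_lt_top : M.hazardSup < ∞

/-- `D` is a De Vylder type approximation of order `k` of `M`: the first `k` moments of the two
reserves agree at all times and for all initial reserves. -/
def IsDeVylder (k : ℕ) (M : RiskModel.{v}) (D : RiskModel.{w}) : Prop :=
  ∀ i : ℕ, 1 ≤ i → i ≤ k → ∀ t : ℝ, 0 ≤ t → ∀ u : ℝ, 0 ≤ u →
    ∫ ω, M.reserve u t ω ^ i ∂M.P = ∫ ω, D.reserve u t ω ^ i ∂D.P

/-- The conditional `j`-th moments of the deficits at ruin of `M` and `D` exist (and are finite),
the one of `M` does not vanish, and the absolute and the relative error are at most `C`. -/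
def DeficitErrorLe (M : RiskModel.{v}) (D : RiskModel.{w}) (j : ℕ) (u C : ℝ) : Prop :=
  0 < M.P (M.ruin u) ∧ 0 < D.P (D.ruin u) ∧
  Integrable (fun ω => M.deficit u ω ^ j) (ProbabilityTheory.cond M.P (M.ruin u)) ∧
  Integrable (fun ω => D.deficit u ω ^ j) (ProbabilityTheory.cond D.P (D.ruin u)) ∧
  0 < M.deficitMoment j u ∧
  |M.deficitMoment j u - D.deficitMoment j u| ≤ C ∧
  |(M.deficitMoment j u - D.deficitMoment j u) / M.deficitMoment j u| ≤ C

end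

end RiskModel

/-! Between claims the reserve increases, so ruin can only occur at a claim, and the deficit at ruin
is that of the random walk with increments `c W - Z` at its first exit from `[0, ∞)`. Write `ψ_j(u)
= E[|U_T|^j; T < ∞]`, so that `d_j = ψ_j / ψ_0`, and let `a = λ / c` and `G(x) = P(Z > x)`. Since
the upward moves are exponential, conditioning on one step and applying Fubini gives the defective
renewal equation `ψ_j(u) = a ∫_0^u ψ_j(v) G(u - v) dv + a ∫_u^∞ (x - u)^j G(x) dx`
(`ruinMoment_renewal`); the integrability that it needs comes from a Lundberg inequality.

After multiplication by `e^{Ru}` the kernel `γ(x) = a e^{Rx} G(x)` is a probability density. A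
solution of `Y = Y * γ + y` satisfies `∫_0^t Y(s) γ((t - s, ∞)) ds = ∫_0^t y`. Together with the
one-sided growth control `Y(v) ≤ e^{(a+R)(v-u)} Y(u)` for `u ≤ v`, this identity bounds `Y` above
and below by explicit positive constants, uniformly in `u` (`mul_solution_le`, `le_mul_solution`);
no asymptotics as `u → ∞` are used. The constants involve only `m_1`, a lower bound on `a`, and
upper bounds on the tilted moment and the hazard rate. They do not degenerate as `R → 0`, which
makes the estimate uniform for small `θ`. The factor `e^{Ru}` cancels in `ψ_j / ψ_0`, so each
conditional moment lies in a fixed interval `[b, B]` with `b > 0`, and both error bounds follow.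

Moment matching enters through the derivative at `t = 0` of `E[U_t(0)^i]`, namely `λ (-1)^i m_i`,
plus `c` when `i = 1`. Hence the drifts `c - λ m_1` and the products `λ m_i`, `2 ≤ i ≤ k`, agree.
This bounds the claim rate of the approximation from below. At `u = 0` the convolution vanishes,
which gives the exact formulas, and the equality of `λ m_2` and of `λ m_{j+1}` reduces the relative
error to the first two moments.

For fixed claim laws, the adjustment coefficients and hence the tilted moments are controlled by
those at `θmax`, so the second uniformity statement follows from the first. -/

/-! ### Random walks killed when they become negative -/

namespace KilledWalk

noncomputable section

/-- The mean of `f` after one step of law `μ` from `u`. -/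
def stepMean (μ : Measure ℝ) (f : ℝ → ℝ≥0∞) (u : ℝ) : ℝ≥0∞ := ∫⁻ x, f (u + x) ∂μ

/-- One step of the walk killed on the negative half-line. -/
def killedMean (μ : Measure ℝ) (f : ℝ → ℝ≥0∞) : ℝ → ℝ≥0∞ := (Ici 0).indicator (stepMean μ f)

/-- The mean of `φ` at the exit from `[0, ∞)`, for `φ` supported on the negative half-line. -/
def exitValue (μ : Measure ℝ) (φ : ℝ → ℝ≥0∞) (x : ℝ) : ℝ≥0∞ := ∑' n, (killedMean μ)^[n] φ x

/-- The position after `n + 1` steps of the walk started from `u` with increments `x`. -/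
def position (u : ℝ) (x : ℕ → ℝ) (n : ℕ) : ℝ := u + ∑ i ∈ Finset.range (n + 1), x i

/-- The indicator that the first `n` positions are nonnegative. -/
def alive (u : ℝ) (x : ℕ → ℝ) (n : ℕ) : ℝ≥0∞ :=
  ∏ i ∈ Finset.range n, (Ici (0 : ℝ)).indicator 1 (position u x i)

variable {μ : Measure ℝ} {f φ : ℝ → ℝ≥0∞}

lemma measurable_stepMean [SFinite μ] (hf : Measurable f) : Measurable (stepMean μ f) := by
  unfold stepMean
  exact Measurable.lintegral_prod_right' (f := fun p : ℝ × ℝ => f (p.1 + p.2)) (by fun_prop)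

lemma measurable_killedMean [SFinite μ] (hf : Measurable f) : Measurable (killedMean μ f) :=
  (measurable_stepMean hf).indicator measurableSet_Ici

lemma measurable_killedMean_iterate [SFinite μ] (n : ℕ) :
    ∀ {f : ℝ → ℝ≥0∞}, Measurable f → Measurable ((killedMean μ)^[n] f) := by
  induction n with
  | zero => exact fun hf => hf
  | succ n ih => exact fun hf => ih (measurable_killedMean hf)

lemma measurable_exitValue [SFinite μ] (hφ : Measurable φ) : Measurable (exitValue μ φ) :=
  Measurable.tsum fun n => measurable_killedMean_iterate n hφ

lemma stepMean_exitValue [SFinite μ] (hφ : Measurable φ) (u : ℝ) :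
    stepMean μ (exitValue μ φ) u = ∑' n, stepMean μ ((killedMean μ)^[n] φ) u := by
  unfold stepMean exitValue
  rw [lintegral_tsum]
  exact fun n => ((measurable_killedMean_iterate n hφ).comp (measurable_const_add u)).aemeasurable

/-- First-step decomposition: the term `n = 0` of the series is `φ`, and shifting the index in the
rest extracts one killed step. -/
lemma exitValue_eq [SFinite μ] (hφ : Measurable φ) (x : ℝ) :
    exitValue μ φ x = φ x + (Ici 0).indicator (stepMean μ (exitValue μ φ)) x := by
  rw [exitValue, tsum_eq_zero_add' ENNReal.summable]
  congr 1
  by_cases hx : x ∈ Ici (0 : ℝ)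
  · simp only [Function.iterate_succ_apply', killedMean, indicator_of_mem hx]
    rw [stepMean_exitValue hφ]
  · simp [Function.iterate_succ_apply', killedMean, indicator_of_notMem hx]

lemma exitValue_of_neg [SFinite μ] (hφ : Measurable φ) {x : ℝ} (hx : x < 0) :
    exitValue μ φ x = φ x := by
  rw [exitValue_eq hφ, indicator_of_notMem (by simpa using hx), add_zero]

lemma exitValue_of_nonneg [SFinite μ] (hφ : Measurable φ) (h0 : ∀ x, 0 ≤ x → φ x = 0) {x : ℝ}
    (hx : 0 ≤ x) : exitValue μ φ x = stepMean μ (exitValue μ φ) x := by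
  rw [exitValue_eq hφ, indicator_of_mem (by simpa using hx), h0 x hx, zero_add]

/-- The exit value is the smallest supersolution. -/
lemma exitValue_le [SFinite μ] (hφ : Measurable φ) (h0 : ∀ x, 0 ≤ x → φ x = 0) {g : ℝ → ℝ≥0∞}
    (hneg : ∀ x, x < 0 → φ x ≤ g x) (hnonneg : ∀ x, 0 ≤ x → stepMean μ g x ≤ g x) (x : ℝ) :
    exitValue μ φ x ≤ g x := by
  have key : ∀ n : ℕ, ∀ x, ∑ i ∈ Finset.range n, (killedMean μ)^[i] φ x ≤ g x := by
    intro n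
    induction n with
    | zero => simp
    | succ n ih =>
      intro x
      -- Splitting off the term `i = 0` exhibits the partial sum of length `n + 1` as `φ` plus one
      -- killed step of the partial sum of length `n`.
      rw [Finset.sum_range_succ']
      rcases lt_or_ge x 0 with hx | hx
      · simp only [Function.iterate_succ_apply', killedMean,
          indicator_of_notMem (show x ∉ Ici (0 : ℝ) by simpa using hx), Finset.sum_const_zero,
          zero_add, Function.iterate_zero, id_eq]
        exact hneg x hx
      · simp only [Function.iterate_succ_apply', killedMean,
          indicator_of_mem (show x ∈ Ici (0 : ℝ) by simpa using hx), Function.iterate_zero, id_eq,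
          h0 x hx, add_zero]
        refine le_trans ?_ (hnonneg x hx)
        unfold stepMean
        rw [← lintegral_finsetSum]
        · exact lintegral_mono fun y => ih (x + y)
        · exact fun i _ => (measurable_killedMean_iterate i hφ).comp (measurable_const_add x)
  rw [exitValue, ENNReal.tsum_eq_iSup_nat]
  exact iSup_le fun n => key n x

lemma measurable_position (u : ℝ) (n : ℕ) : Measurable fun x : ℕ → ℝ => position u x n := by
  unfold position; fun_prop

lemma measurable_alive (u : ℝ) (n : ℕ) : Measurable fun x : ℕ → ℝ => alive u x n := by
  unfold alive
  exact Finset.measurable_prod _ fun i _ =>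
    (measurable_one.indicator measurableSet_Ici).comp (measurable_position u i)

lemma position_congr {u : ℝ} {x y : ℕ → ℝ} {n : ℕ} (h : ∀ i ≤ n, x i = y i) :
    position u x n = position u y n := by
  unfold position
  congr 1
  exact Finset.sum_congr rfl fun i hi => h i (by simp at hi; omega)

lemma alive_congr {u : ℝ} {x y : ℕ → ℝ} {n : ℕ} (h : ∀ i < n, x i = y i) :
    alive u x n = alive u y n := by
  unfold alive
  refine Finset.prod_congr rfl fun i hi => ?_
  rw [position_congr fun l hl => h l (by simp at hi; omega)]

lemma lintegral_comp_of_indepFun {Ω β γ : Type*} [MeasurableSpace Ω] [MeasurableSpace β]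
    [MeasurableSpace γ] {P : Measure Ω} [IsFiniteMeasure P] {X : Ω → β} {Y : Ω → γ}
    (hX : Measurable X) (hY : Measurable Y) (h : IndepFun X Y P) {g : β × γ → ℝ≥0∞}
    (hg : Measurable g) :
    ∫⁻ ω, g (X ω, Y ω) ∂P = ∫⁻ ω, ∫⁻ y, g (X ω, y) ∂(P.map Y) ∂P := by
  rw [← lintegral_map (f := g) hg (hX.prodMk hY),
    (indepFun_iff_map_prod_eq_prod_map_map hX.aemeasurable hY.aemeasurable).1 h,
    lintegral_prod _ hg.aemeasurable]
  rw [lintegral_map hg.lintegral_prod_right' hX]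

/-- The last increment is integrated out first, which replaces `f` by `killedMean μ f`; hence the
induction on `n` with `f` arbitrary. Only positions reached after at least one step are tested for
sign, never `u` itself, so the outermost operator is the unkilled `stepMean`. -/
lemma lintegral_alive_mul {Ω : Type*} [MeasurableSpace Ω] {P : Measure Ω} [IsProbabilityMeasure P]
    {ξ : ℕ → Ω → ℝ} (hξ : ∀ i, Measurable (ξ i))
    (hind : ∀ n, IndepFun (fun ω (i : Finset.range (n + 1)) => ξ i ω) (ξ (n + 1)) P)
    (hlaw : ∀ i, P.map (ξ i) = μ) (u : ℝ) (n : ℕ) :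
    ∀ {f : ℝ → ℝ≥0∞}, Measurable f →
      ∫⁻ ω, alive u (fun i => ξ i ω) n * f (position u (fun i => ξ i ω) n) ∂P =
        stepMean μ ((killedMean μ)^[n] f) u := by
  have hμ : SFinite μ := hlaw 0 ▸ inferInstance
  induction n with
  | zero =>
    intro f hf
    simp only [alive, position, Finset.range_zero, Finset.prod_empty, one_mul, zero_add,
      Finset.sum_range_one, Function.iterate_zero, id_eq, stepMean]
    rw [← hlaw 0, lintegral_map (by fun_prop) (hξ 0)]
  | succ n ih =>
    intro f hf
    rw [Function.iterate_succ_apply, ← ih (measurable_killedMean hf)]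
    -- The past padded with zeros: a sequence depending only on the first `n + 1` increments, hence
    -- independent of the next one, with the same first `n + 1` positions.
    set X : Ω → ℕ → ℝ := fun ω i => if i ≤ n then ξ i ω else 0 with hXdef
    have hX : Measurable X := by
      refine measurable_pi_lambda _ fun i => ?_
      by_cases h : i ≤ n
      · simpa [hXdef, h] using hξ i
      · simp [hXdef, h]
    have hXind : IndepFun X (ξ (n + 1)) P := by
      have h1 : Measurable fun (y : Finset.range (n + 1) → ℝ) (i : ℕ) =>
          if h : i ∈ Finset.range (n + 1) then y ⟨i, h⟩ else 0 := by
        refine measurable_pi_lambda _ fun i => ?_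
        by_cases h : i ∈ Finset.range (n + 1)
        · simpa only [h, dif_pos] using measurable_pi_apply _
        · simp [h]
      have h3 := (hind n).comp h1 measurable_id
      have e : X = (fun (y : Finset.range (n + 1) → ℝ) (i : ℕ) =>
          if h : i ∈ Finset.range (n + 1) then y ⟨i, h⟩ else 0) ∘
            fun ω (i : Finset.range (n + 1)) => ξ i ω := by
        ext ω i
        by_cases hi : i ≤ n <;> simp [hXdef, hi]
      rw [e]
      exact h3
    have e1 : ∀ ω, alive u (fun i => ξ i ω) (n + 1) = alive u (X ω) (n + 1) := fun ω =>
      alive_congr fun i hi => by simp [hXdef, Nat.lt_succ_iff.1 hi]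
    have e1' : ∀ ω, alive u (fun i => ξ i ω) n = alive u (X ω) n := fun ω =>
      alive_congr fun i hi => by simp [hXdef, hi.le]
    have e2 : ∀ ω, position u (fun i => ξ i ω) n = position u (X ω) n := fun ω =>
      position_congr fun i hi => by simp [hXdef, hi]
    have e3 : ∀ ω, position u (fun i => ξ i ω) (n + 1) = position u (X ω) n + ξ (n + 1) ω := by
      intro ω
      rw [← e2, position, position, Finset.sum_range_succ, ← add_assoc]
    simp only [e1, e1', e2, e3]
    rw [lintegral_comp_of_indepFun (g := fun p : (ℕ → ℝ) × ℝ =>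
      alive u p.1 (n + 1) * f (position u p.1 n + p.2)) hX (hξ _) hXind ?_, hlaw]
    · refine lintegral_congr fun ω => ?_
      dsimp only
      rw [lintegral_const_mul _ (by fun_prop), alive, Finset.prod_range_succ, ← alive, mul_assoc]
      congr 1
      by_cases h : position u (X ω) n ∈ Ici (0 : ℝ)
      · simp [killedMean, indicator_of_mem h, stepMean]
      · simp [killedMean, indicator_of_notMem h]
    · exact ((measurable_alive u (n + 1)).comp measurable_fst).mul
        (hf.comp (((measurable_position u n).comp measurable_fst).add measurable_snd))

lemma lintegral_tsum_alive_mul {Ω : Type*} [MeasurableSpace Ω] {P : Measure Ω}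
    [IsProbabilityMeasure P] {ξ : ℕ → Ω → ℝ} (hξ : ∀ i, Measurable (ξ i))
    (hind : ∀ n, IndepFun (fun ω (i : Finset.range (n + 1)) => ξ i ω) (ξ (n + 1)) P)
    (hlaw : ∀ i, P.map (ξ i) = μ) (hφ : Measurable φ) (u : ℝ) :
    ∫⁻ ω, ∑' n, alive u (fun i => ξ i ω) n * φ (position u (fun i => ξ i ω) n) ∂P =
      stepMean μ (exitValue μ φ) u := by
  have hμ : SFinite μ := hlaw 0 ▸ inferInstance
  rw [lintegral_tsum, stepMean_exitValue hφ]
  · exact tsum_congr fun n => lintegral_alive_mul hξ hind hlaw u n hφ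
  · exact fun n => (((measurable_alive u n).comp (measurable_pi_lambda _ hξ)).mul
      (hφ.comp ((measurable_position u n).comp (measurable_pi_lambda _ hξ)))).aemeasurable

/-- Only the first negative position contributes to the exit functional. -/
lemma tsum_alive_mul_eq {u : ℝ} {x : ℕ → ℝ} {n : ℕ} (h0 : ∀ x, 0 ≤ x → φ x = 0)
    (hlt : ∀ i < n, 0 ≤ position u x i) (hn : position u x n < 0) :
    ∑' i, alive u x i * φ (position u x i) = φ (position u x n) := by
  rw [tsum_eq_single n]
  · rw [alive, Finset.prod_eq_one, one_mul]
    intro i hi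
    simp [hlt i (Finset.mem_range.1 hi)]
  · intro i hi
    rcases lt_or_gt_of_ne hi with h | h
    · rw [h0 _ (hlt i h), mul_zero]
    · rw [alive, Finset.prod_eq_zero (Finset.mem_range.2 h), zero_mul]
      simp [hn]

lemma tsum_alive_mul_eq_zero {u : ℝ} {x : ℕ → ℝ} (h0 : ∀ x, 0 ≤ x → φ x = 0)
    (hx : ∀ i, 0 ≤ position u x i) :
    ∑' i, alive u x i * φ (position u x i) = 0 := by
  simp [h0 _ (hx _)]

end

end KilledWalk

/-! ### Exponential upward moves and the renewal equation -/

namespace KilledWalk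

noncomputable section

/-- The mean of `f` after an exponential upward move of rate `a` and a downward jump of law `F`. -/
def expStepMean (a : ℝ) (F : Measure ℝ) (f : ℝ → ℝ≥0∞) (u : ℝ) : ℝ≥0∞ :=
  ∫⁻ s in Ioi u, ENNReal.ofReal (a * Real.exp (-(a * (s - u)))) * ∫⁻ z, f (s - z) ∂F

variable {a : ℝ} {F : Measure ℝ} {f : ℝ → ℝ≥0∞}

lemma measurable_jumpMean [SFinite F] (hf : Measurable f) :
    Measurable fun s => ∫⁻ z, f (s - z) ∂F :=
  Measurable.lintegral_prod_right' (f := fun p : ℝ × ℝ => f (p.1 - p.2)) (by fun_prop)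

lemma measurable_meas_Ioi [IsFiniteMeasure F] : Measurable fun x => F (Ioi x) :=
  (Antitone.measurable fun _ _ h => measure_mono (Ioi_subset_Ioi h))

/-- Memorylessness: from `u`, the move exceeds `v` with probability `e^{-a(v-u)}` and then continues
as if started at `v`; the moves that stop before `v` are discarded. -/
lemma expStepMean_le {u v : ℝ} (huv : u ≤ v) :
    expStepMean a F f v ≤ ENNReal.ofReal (Real.exp (a * (v - u))) * expStepMean a F f u := by
  unfold expStepMean
  rw [← lintegral_const_mul' _ _ ENNReal.ofReal_ne_top]
  refine (lintegral_mono_set (Ioi_subset_Ioi huv)).trans' (le_of_eq ?_)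
  refine lintegral_congr fun s => ?_
  rw [← mul_assoc, ← ENNReal.ofReal_mul (Real.exp_pos _).le]
  congr 2
  rw [mul_left_comm, ← Real.exp_add]
  ring_nf

lemma lintegral_exp_Ioo_add (ha : 0 < a) {u s : ℝ} (hus : u ≤ s) :
    (∫⁻ v in Ioo u s, ENNReal.ofReal (a * Real.exp (-(a * (s - v))))) +
      ENNReal.ofReal (Real.exp (-(a * (s - u)))) = 1 := by
  have hd : ∀ v ∈ uIcc u s, HasDerivAt (fun v => Real.exp (-(a * (s - v))))
      (a * Real.exp (-(a * (s - v)))) v := by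
    intro v _
    have h : HasDerivAt (fun v => -(a * (s - v))) a v := by
      have := (((hasDerivAt_id' v).const_sub s).const_mul a).fun_neg
      simpa using this
    simpa [mul_comm] using h.exp
  have hc : Continuous fun v => a * Real.exp (-(a * (s - v))) := by fun_prop
  have hi := intervalIntegral.integral_eq_sub_of_hasDerivAt hd (hc.intervalIntegrable _ _)
  rw [intervalIntegral.integral_of_le hus, integral_Ioc_eq_integral_Ioo] at hi
  rw [← ofReal_integral_eq_lintegral_ofReal, hi, ← ENNReal.ofReal_add]
  · simp
  · simp only [sub_self, mul_zero, neg_zero, Real.exp_zero, sub_nonneg]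
    exact Real.exp_le_one_iff.2 (by nlinarith)
  · positivity
  · exact (hc.integrableOn_Icc (a := u) (b := s)).mono_set Ioo_subset_Icc_self
  · exact Filter.Eventually.of_forall fun v => by positivity

/-- Integrated form of the equation `g' = a g - a h` satisfied by `g = expStepMean a F f`, with `h`
the jump mean. Tonelli replaces differentiation, so no regularity of `f` is needed. -/
lemma lintegral_expStepMean_add [SFinite F] (ha : 0 < a) (hf : Measurable f) (u : ℝ) :
    ENNReal.ofReal a * (∫⁻ v in Ioi u, expStepMean a F f v) + expStepMean a F f u =
      ENNReal.ofReal a * ∫⁻ s in Ioi u, ∫⁻ z, f (s - z) ∂F := by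
  set h : ℝ → ℝ≥0∞ := fun s => ∫⁻ z, f (s - z) ∂F with hh
  have hm : Measurable h := measurable_jumpMean hf
  have e1 : ∫⁻ v in Ioi u, expStepMean a F f v =
      ∫⁻ s in Ioi u, (∫⁻ v in Ioo u s, ENNReal.ofReal (a * Real.exp (-(a * (s - v))))) * h s := by
    have : ∀ v ∈ Ioi u, expStepMean a F f v = ∫⁻ s in Ioi u,
        (Iio s).indicator (fun v => ENNReal.ofReal (a * Real.exp (-(a * (s - v))))) v * h s := by
      intro v hv
      have : ∀ s, (Iio s).indicator (fun v => ENNReal.ofReal (a * Real.exp (-(a * (s - v))))) v * h s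
          = (Ioi v).indicator (fun s => ENNReal.ofReal (a * Real.exp (-(a * (s - v)))) * h s) s := by
        intro s
        by_cases hs : v < s <;> simp [hs]
      simp_rw [this]
      rw [lintegral_indicator measurableSet_Ioi, Measure.restrict_restrict measurableSet_Ioi,
        inter_eq_left.2 (Ioi_subset_Ioi (le_of_lt hv))]
      rfl
    rw [setLIntegral_congr_fun measurableSet_Ioi this, lintegral_lintegral_swap]
    · refine lintegral_congr fun s => ?_
      rw [lintegral_mul_const _ (Measurable.indicator (by fun_prop) measurableSet_Iio),
        lintegral_indicator measurableSet_Iio,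
        Measure.restrict_restrict measurableSet_Iio, inter_comm, Ioi_inter_Iio]
    · refine AEMeasurable.mul ?_ (hm.comp measurable_snd).aemeasurable
      refine Measurable.aemeasurable ?_
      have : Measurable fun p : ℝ × ℝ => {p : ℝ × ℝ | p.1 < p.2}.indicator
          (fun p => ENNReal.ofReal (a * Real.exp (-(a * (p.2 - p.1))))) p :=
        Measurable.indicator (by fun_prop) (measurableSet_lt measurable_fst measurable_snd)
      exact this
  have e2 : expStepMean a F f u = ENNReal.ofReal a *
      ∫⁻ s in Ioi u, ENNReal.ofReal (Real.exp (-(a * (s - u)))) * h s := by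
    rw [← lintegral_const_mul' _ _ ENNReal.ofReal_ne_top]
    refine lintegral_congr fun s => ?_
    rw [← mul_assoc, ← ENNReal.ofReal_mul ha.le]
  rw [e1, e2, ← mul_add, ← lintegral_add_right _ (by fun_prop)]
  congr 1
  refine setLIntegral_congr_fun measurableSet_Ioi fun s hs => ?_
  rw [← add_mul, lintegral_exp_Ioo_add ha (le_of_lt hs), one_mul]

/-- The defective renewal equation of a walk with exponential upward moves. -/
theorem expStepMean_renewal [IsProbabilityMeasure F] (ha : 0 < a) (hF : F (Iic 0) = 0)
    (hf : Measurable f) (hfix : ∀ v, 0 ≤ v → f v = expStepMean a F f v)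
    {u : ℝ} (hu : 0 ≤ u) (hfin : ∫⁻ v in Ioi u, f v ≠ ∞) :
    f u = ENNReal.ofReal a * ((∫⁻ v in Icc 0 u, f v * F (Ioi (u - v))) +
      ∫⁻ s in Ioi u, ∫⁻ z in Ioi s, f (s - z) ∂F) := by
  have e0 := lintegral_expStepMean_add (F := F) ha hf u
  have e1 : ∫⁻ v in Ioi u, expStepMean a F f v = ∫⁻ v in Ioi u, f v :=
    setLIntegral_congr_fun measurableSet_Ioi fun v hv => (hfix v (hu.trans (le_of_lt hv))).symm
  have e2 : ∫⁻ s in Ioi u, ∫⁻ z, f (s - z) ∂F =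
      (∫⁻ s in Ioi u, ∫⁻ z in Iic s, f (s - z) ∂F) +
        ∫⁻ s in Ioi u, ∫⁻ z in Ioi s, f (s - z) ∂F := by
    rw [← lintegral_add_left]
    · refine lintegral_congr fun s => ?_
      rw [← compl_Iic, lintegral_add_compl _ measurableSet_Iic]
    · have : Measurable fun p : ℝ × ℝ => {p : ℝ × ℝ | p.2 ≤ p.1}.indicator
          (fun p => f (p.1 - p.2)) p :=
        Measurable.indicator (by fun_prop) (measurableSet_le measurable_snd measurable_fst)
      have := this.lintegral_prod_right' (ν := F)
      simp_rw [← lintegral_indicator measurableSet_Iic]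
      exact this
  -- Substitute `v = s - z`, the position after the jump; then `s > u` becomes `z > u - v`.
  have e3 : ∫⁻ s in Ioi u, ∫⁻ z in Iic s, f (s - z) ∂F =
      ∫⁻ v in Ici 0, f v * F (Ioi (u - v)) := by
    have h1 : ∀ s z : ℝ, (Ioi u).indicator 1 s * (Iic s).indicator (fun z => f (s - z)) z =
        (Ioi (u - z)).indicator 1 (s - z) * (Ici 0).indicator f (s - z) := by
      intro s z
      by_cases hs : u < s <;> by_cases hz : z ≤ s <;> simp [hs, hz]
    calc ∫⁻ s in Ioi u, ∫⁻ z in Iic s, f (s - z) ∂F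
        = ∫⁻ s, ∫⁻ z, (Ioi (u - z)).indicator 1 (s - z) * (Ici 0).indicator f (s - z) ∂F := by
          rw [← lintegral_indicator measurableSet_Ioi]
          refine lintegral_congr fun s => ?_
          simp_rw [← h1]
          rw [lintegral_const_mul' _ _ (by by_cases hs : u < s <;> simp [hs]),
            lintegral_indicator measurableSet_Iic]
          by_cases hs : u < s <;> simp [hs]
      _ = ∫⁻ z, (∫⁻ s, (Ioi (u - z)).indicator 1 (s - z) * (Ici 0).indicator f (s - z)) ∂F := by
          refine lintegral_lintegral_swap (Measurable.aemeasurable ?_)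
          refine Measurable.mul ?_ ((hf.indicator measurableSet_Ici).comp (by fun_prop))
          have : Measurable fun p : ℝ × ℝ => {p : ℝ × ℝ | u < p.1}.indicator
            (1 : ℝ × ℝ → ℝ≥0∞) p := measurable_one.indicator
              (measurableSet_lt measurable_const measurable_fst)
          convert this using 2 with p
          by_cases hp : u < p.1 <;> simp [hp]
      _ = ∫⁻ z, (∫⁻ v, (Ioi (u - z)).indicator 1 v * (Ici 0).indicator f v) ∂F :=
          lintegral_congr fun z => lintegral_sub_right_eq_self (μ := volume)
            (fun v => (Ioi (u - z)).indicator 1 v * (Ici 0).indicator f v) z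
      _ = ∫⁻ v, ∫⁻ z, (Ioi (u - z)).indicator 1 v * (Ici 0).indicator f v ∂F := by
          refine lintegral_lintegral_swap (Measurable.aemeasurable ?_)
          refine Measurable.mul ?_ ((hf.indicator measurableSet_Ici).comp (by fun_prop))
          have : Measurable fun p : ℝ × ℝ => {p : ℝ × ℝ | u - p.1 < p.2}.indicator
            (1 : ℝ × ℝ → ℝ≥0∞) p := measurable_one.indicator
              (measurableSet_lt (by fun_prop) measurable_snd)
          exact this
      _ = ∫⁻ v in Ici 0, f v * F (Ioi (u - v)) := by
          rw [← lintegral_indicator measurableSet_Ici]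
          refine lintegral_congr fun v => ?_
          have h2 : ∀ z : ℝ, (Ioi (u - z)).indicator (1 : ℝ → ℝ≥0∞) v =
              (Ioi (u - v)).indicator 1 z := by
            intro z
            have : v ∈ Ioi (u - z) ↔ z ∈ Ioi (u - v) := by
              simp only [mem_Ioi]; constructor <;> intro h <;> linarith
            simp only [indicator_apply, this, Pi.one_apply]
          simp_rw [h2]
          rw [lintegral_mul_const _ (measurable_one.indicator measurableSet_Ioi),
            lintegral_indicator_one measurableSet_Ioi, mul_comm]
          by_cases hv : 0 ≤ v <;> simp [hv]
  -- For `v > u` the level `u - v` is negative and the tail of `F` there equals 1. This creates the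
  -- integral of `f` over `(u, ∞)` that cancels against the left side of `e0`; the cancellation is
  -- where `hfin` is needed.
  have e4 : ∫⁻ v in Ici 0, f v * F (Ioi (u - v)) =
      (∫⁻ v in Icc 0 u, f v * F (Ioi (u - v))) + ∫⁻ v in Ioi u, f v := by
    rw [← Icc_union_Ioi_eq_Ici hu, lintegral_union measurableSet_Ioi]
    · congr 1
      refine setLIntegral_congr_fun measurableSet_Ioi fun v hv => ?_
      rw [show F (Ioi (u - v)) = 1 from ?_, mul_one]
      rw [← prob_compl_eq_zero_iff measurableSet_Ioi, compl_Ioi]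
      exact measure_mono_null (Iic_subset_Iic.2 (sub_nonpos.2 (le_of_lt hv))) hF
    · exact disjoint_left.2 fun x hx hx' => absurd hx.2 (not_le.2 hx')
  rw [e1, ← hfix u hu, e2, e3, e4, add_comm (∫⁻ v in Icc 0 u, _), add_assoc, mul_add] at e0
  exact (ENNReal.add_right_inj (ENNReal.mul_ne_top ENNReal.ofReal_ne_top hfin)).1 e0

end

end KilledWalk

/-! ### Bounds for solutions of a renewal equation -/

namespace RenewalEquation

noncomputable section

variable {Z z γ : ℝ → ℝ≥0∞}

lemma measurable_tail (γ : ℝ → ℝ≥0∞) : Measurable fun x => ∫⁻ y in Ioi x, γ y :=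
  Antitone.measurable fun _ _ h => lintegral_mono_set (Ioi_subset_Ioi h)

lemma measurable_tail_sub (γ : ℝ → ℝ≥0∞) (c : ℝ) :
    Measurable fun s => ∫⁻ y in Ioi (c - s), γ y :=
  (measurable_tail γ).comp (measurable_const.sub measurable_id)

/-- Integrate the renewal equation over `[0, t]`: the convolution contributes `Z s` times the mass
of `γ` on `(0, t - s]`. Since `γ` has total mass one, subtracting this from the integral of `Z`
leaves the tail mass. -/
lemma lintegral_mul_tail (hZm : Measurable Z) (hzm : Measurable z) (hγm : Measurable γ)
    {t : ℝ} (hZ : ∀ u, 0 ≤ u → Z u = (∫⁻ v in Icc 0 u, Z v * γ (u - v)) + z u)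
    (hγ : ∫⁻ x in Ioi 0, γ x = 1) (hfin : ∫⁻ s in Icc 0 t, Z s ≠ ∞) :
    ∫⁻ s in Icc 0 t, Z s * ∫⁻ x in Ioi (t - s), γ x = ∫⁻ s in Icc 0 t, z s := by
  have e1 : ∫⁻ u in Icc 0 t, ∫⁻ v in Icc 0 u, Z v * γ (u - v) =
      ∫⁻ v in Icc 0 t, Z v * ∫⁻ x in Ioc 0 (t - v), γ x := by
    calc ∫⁻ u in Icc 0 t, ∫⁻ v in Icc 0 u, Z v * γ (u - v)
        = ∫⁻ u in Icc 0 t, ∫⁻ v in Icc 0 t, (Iic u).indicator (fun v => Z v * γ (u - v)) v := by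
          refine setLIntegral_congr_fun measurableSet_Icc fun u hu => ?_
          rw [lintegral_indicator measurableSet_Iic, Measure.restrict_restrict measurableSet_Iic]
          congr 2
          ext v
          simp only [mem_Icc, mem_inter_iff, mem_Iic] at hu ⊢
          constructor
          · exact fun h => ⟨h.2, h.1, h.2.trans hu.2⟩
          · exact fun h => ⟨h.2.1, h.1⟩
      _ = ∫⁻ v in Icc 0 t, ∫⁻ u in Icc 0 t, (Iic u).indicator (fun v => Z v * γ (u - v)) v := by
          refine lintegral_lintegral_swap (Measurable.aemeasurable ?_)
          have : Measurable fun p : ℝ × ℝ => {p : ℝ × ℝ | p.2 ≤ p.1}.indicator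
              (fun p => Z p.2 * γ (p.1 - p.2)) p :=
            Measurable.indicator (by fun_prop) (measurableSet_le measurable_snd measurable_fst)
          exact this
      _ = ∫⁻ v in Icc 0 t, Z v * ∫⁻ x in Ioc 0 (t - v), γ x := by
          refine setLIntegral_congr_fun measurableSet_Icc fun v hv => ?_
          have h1 : ∀ u, (Iic u).indicator (fun v => Z v * γ (u - v)) v =
              Z v * (Ici 0).indicator γ (u - v) := by
            intro u
            by_cases h : v ≤ u <;> simp [h]
          simp_rw [h1]
          have hm : Measurable fun u => (Ici 0).indicator γ (u - v) :=
            (hγm.indicator measurableSet_Ici).comp (measurable_id.sub_const v)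
          rw [lintegral_const_mul _ hm]
          congr 1
          have h2 : ∀ u, (Icc 0 t).indicator (fun u => (Ici 0).indicator γ (u - v)) u =
              (Icc 0 (t - v)).indicator γ (u - v) := by
            intro u
            have : u - v ∈ Icc 0 (t - v) ↔ u ∈ Icc 0 t ∧ u - v ∈ Ici 0 := by
              simp only [mem_Icc, mem_Ici] at hv ⊢
              constructor
              · rintro ⟨h1, h2⟩
                exact ⟨⟨by linarith, by linarith⟩, h1⟩
              · rintro ⟨⟨h1, h2⟩, h3⟩
                exact ⟨h3, by linarith⟩
            by_cases ha : u ∈ Icc 0 t <;> by_cases hb : u - v ∈ Ici 0 <;>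
              simp only [indicator_apply, this, ha, hb] <;> simp
          rw [← lintegral_indicator measurableSet_Icc, lintegral_congr h2,
            lintegral_sub_right_eq_self (fun x => (Icc 0 (t - v)).indicator γ x) v,
            lintegral_indicator measurableSet_Icc, restrict_Ioc_eq_restrict_Icc]
  have e2 : ∫⁻ s in Icc 0 t, Z s = (∫⁻ v in Icc 0 t, Z v * ∫⁻ x in Ioc 0 (t - v), γ x) +
      ∫⁻ s in Icc 0 t, z s := by
    rw [← e1, ← lintegral_add_right _ hzm]
    exact setLIntegral_congr_fun measurableSet_Icc fun u hu => hZ u hu.1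
  have e3 : ∫⁻ s in Icc 0 t, Z s = (∫⁻ v in Icc 0 t, Z v * ∫⁻ x in Ioc 0 (t - v), γ x) +
      ∫⁻ s in Icc 0 t, Z s * ∫⁻ x in Ioi (t - s), γ x := by
    rw [← lintegral_add_right _ (hZm.fun_mul (measurable_tail_sub γ t))]
    refine setLIntegral_congr_fun measurableSet_Icc fun s hs => ?_
    rw [← mul_add, ← lintegral_union measurableSet_Ioi (Ioc_disjoint_Ioi le_rfl),
      Ioc_union_Ioi_eq_Ioi (sub_nonneg.2 hs.2), hγ, mul_one]
  have e4 : ∫⁻ v in Icc 0 t, Z v * ∫⁻ x in Ioc 0 (t - v), γ x ≠ ∞ :=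
    ne_top_of_le_ne_top hfin (e3 ▸ le_self_add)
  exact (ENNReal.add_right_inj e4).1 (e3.symm.trans e2)

lemma tail_le_one (hγ : ∫⁻ x in Ioi 0, γ x = 1) {x : ℝ} (hx : 0 ≤ x) :
    ∫⁻ y in Ioi x, γ y ≤ 1 :=
  hγ ▸ lintegral_mono_set (Ioi_subset_Ioi hx)

/-- By `hrise`, `Z u` is at most `e^b` times its integral over `[u - 1, u]`. There the tail in
`lintegral_mul_tail` is at least `δ`, so `δ` times this integral is at most the integral of `z`. For
`u ≤ 1` the comparison is with `Z 0 = z 0`, which explains the extra summand. -/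
lemma mul_solution_le (hZm : Measurable Z) (hzm : Measurable z) (hγm : Measurable γ)
    (hZ : ∀ u, 0 ≤ u → Z u = (∫⁻ v in Icc 0 u, Z v * γ (u - v)) + z u)
    (hγ : ∫⁻ x in Ioi 0, γ x = 1) (hfin : ∀ t, ∫⁻ s in Icc 0 t, Z s ≠ ∞) {b : ℝ} (hb : 0 ≤ b)
    (hrise : ∀ u v, 0 ≤ u → u ≤ v → Z v ≤ ENNReal.ofReal (Real.exp (b * (v - u))) * Z u)
    {δ : ℝ≥0∞} (hδ : δ ≤ ∫⁻ x in Ioi 1, γ x) {u : ℝ} (hu : 0 ≤ u) :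
    δ * Z u ≤ ENNReal.ofReal (Real.exp b) * ((∫⁻ s in Ici 0, z s) + z 0) := by
  have hexp : ∀ s, 0 ≤ s → s ≤ 1 → ENNReal.ofReal (Real.exp (b * s)) ≤
      ENNReal.ofReal (Real.exp b) := fun s h0 h1 =>
    ENNReal.ofReal_le_ofReal (Real.exp_le_exp.2 (by nlinarith))
  rcases le_or_gt u 1 with h1 | h1
  · have hZ0 : Z 0 = z 0 := by rw [hZ 0 le_rfl]; simp
    calc δ * Z u ≤ 1 * Z u := by
          gcongr
          exact hδ.trans (tail_le_one hγ zero_le_one)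
      _ ≤ ENNReal.ofReal (Real.exp b) * Z 0 := by
          rw [one_mul]
          refine (hrise 0 u le_rfl hu).trans ?_
          rw [sub_zero]
          exact mul_le_mul_left (hexp u hu h1) _
      _ ≤ _ := by
          rw [hZ0]
          gcongr
          exact le_add_self
  · have hw : Z u ≤ ENNReal.ofReal (Real.exp b) * ∫⁻ s in Icc (u - 1) u, Z s := by
      rw [← lintegral_const_mul' _ _ ENNReal.ofReal_ne_top]
      calc Z u = ∫⁻ _ in Icc (u - 1) u, Z u := by simp
        _ ≤ _ := by
          refine setLIntegral_mono (by fun_prop) fun s hs => ?_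
          refine (hrise s u (by linarith [hs.1]) hs.2).trans ?_
          exact mul_le_mul_left (hexp _ (by linarith [hs.2]) (by linarith [hs.1])) _
    calc δ * Z u ≤ δ * (ENNReal.ofReal (Real.exp b) * ∫⁻ s in Icc (u - 1) u, Z s) := by gcongr
      _ = ENNReal.ofReal (Real.exp b) * ∫⁻ s in Icc (u - 1) u, Z s * δ := by
          rw [lintegral_mul_const _ hZm]; ring
      _ ≤ ENNReal.ofReal (Real.exp b) *
          ∫⁻ s in Icc 0 u, Z s * ∫⁻ x in Ioi (u - s), γ x := by
          gcongr ENNReal.ofReal (Real.exp b) * ?_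
          refine (setLIntegral_mono (hZm.mul (measurable_tail_sub γ _))
            fun s hs => ?_).trans (lintegral_mono_set (Icc_subset_Icc_left (by linarith)))
          refine mul_le_mul_right (hδ.trans ?_) _
          exact (lintegral_mono_set (Ioi_subset_Ioi (by linarith [hs.1])))
      _ ≤ _ := by
          rw [lintegral_mul_tail hZm hzm hγm hZ hγ (hfin u)]
          exact mul_le_mul_right
            ((lintegral_mono_set Icc_subset_Ici_self).trans le_self_add) _

/-- Apply `lintegral_mul_tail` at `t = u + ℓ`. The times `s ≤ u` contribute at most `δ / 2`, by the
upper bound `B` and the choice of `ℓ`. The other half of `δ` must come from `(u, u + ℓ]`, where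
`hrise` bounds `Z s` by `e^{bℓ} Z u`. -/
lemma le_mul_solution (hZm : Measurable Z) (hzm : Measurable z) (hγm : Measurable γ)
    (hZ : ∀ u, 0 ≤ u → Z u = (∫⁻ v in Icc 0 u, Z v * γ (u - v)) + z u)
    (hγ : ∫⁻ x in Ioi 0, γ x = 1) (hfin : ∀ t, ∫⁻ s in Icc 0 t, Z s ≠ ∞) {b : ℝ} (hb : 0 ≤ b)
    (hrise : ∀ u v, 0 ≤ u → u ≤ v → Z v ≤ ENNReal.ofReal (Real.exp (b * (v - u))) * Z u)
    {δ B : ℝ≥0∞} (hδfin : δ ≠ ∞) (hδ : δ ≤ ∫⁻ s in Icc 0 1, z s) (hB : ∀ u, 0 ≤ u → Z u ≤ B)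
    {ℓ : ℝ} (hℓ : 1 ≤ ℓ) (htail : B * ∫⁻ x in Ici ℓ, ∫⁻ y in Ioi x, γ y ≤ δ / 2)
    {u : ℝ} (hu : 0 ≤ u) :
    δ / 2 ≤ ENNReal.ofReal (ℓ * Real.exp (b * ℓ)) * Z u := by
  have h0 : δ ≤ ∫⁻ s in Icc 0 (u + ℓ), Z s * ∫⁻ x in Ioi (u + ℓ - s), γ x := by
    rw [lintegral_mul_tail hZm hzm hγm hZ hγ (hfin _)]
    exact hδ.trans (lintegral_mono_set (Icc_subset_Icc_right (by linarith)))
  rw [← Icc_union_Ioc_eq_Icc hu (by linarith : u ≤ u + ℓ), lintegral_union measurableSet_Ioc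
    (disjoint_left.2 fun x hx hx' => absurd hx.2 (not_le.2 hx'.1))] at h0
  have h1 : ∫⁻ s in Icc 0 u, Z s * ∫⁻ x in Ioi (u + ℓ - s), γ x ≤ δ / 2 := by
    refine le_trans ?_ htail
    calc ∫⁻ s in Icc 0 u, Z s * ∫⁻ x in Ioi (u + ℓ - s), γ x
        ≤ ∫⁻ s in Icc 0 u, B * ∫⁻ x in Ioi (u + ℓ - s), γ x := by
          refine setLIntegral_mono ((measurable_tail_sub γ _).const_mul _)
            fun s hs => ?_
          gcongr
          exact hB s hs.1
      _ = B * ∫⁻ s in Icc 0 u, ∫⁻ x in Ioi (u + ℓ - s), γ x := by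
          rw [lintegral_const_mul _ (measurable_tail_sub γ _)]
      _ ≤ B * ∫⁻ x in Ici ℓ, ∫⁻ y in Ioi x, γ y := by
          gcongr B * ?_
          rw [← lintegral_indicator measurableSet_Icc, ← lintegral_indicator measurableSet_Ici,
            ← lintegral_sub_left_eq_self ((Ici ℓ).indicator _) (u + ℓ)]
          refine lintegral_mono fun s => ?_
          by_cases hs : s ∈ Icc 0 u
          · have : u + ℓ - s ∈ Ici ℓ := by simp only [mem_Ici]; linarith [hs.2]
            simp only [indicator_of_mem hs, indicator_of_mem this, le_refl]
          · simp [indicator_of_notMem hs]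
  have h2 : ∫⁻ s in Ioc u (u + ℓ), Z s * ∫⁻ x in Ioi (u + ℓ - s), γ x ≤
      ENNReal.ofReal (ℓ * Real.exp (b * ℓ)) * Z u := by
    calc ∫⁻ s in Ioc u (u + ℓ), Z s * ∫⁻ x in Ioi (u + ℓ - s), γ x
        ≤ ∫⁻ _ in Ioc u (u + ℓ), ENNReal.ofReal (Real.exp (b * ℓ)) * Z u := by
          refine setLIntegral_mono measurable_const fun s hs => ?_
          calc _ ≤ Z s * 1 := by
                gcongr
                exact tail_le_one hγ (by linarith [hs.2])
            _ ≤ _ := by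
                rw [mul_one]
                refine (hrise u s hu hs.1.le).trans ?_
                gcongr
                linarith [hs.2]
      _ = _ := by
          rw [setLIntegral_const, Real.volume_Ioc, add_sub_cancel_left,
            ENNReal.ofReal_mul (by linarith : 0 ≤ ℓ)]
          ring
  have h3 := h0.trans (add_le_add h1 h2)
  have h4 : δ / 2 + δ / 2 ≤ δ / 2 + ENNReal.ofReal (ℓ * Real.exp (b * ℓ)) * Z u := by
    rwa [ENNReal.add_halves]
  exact (ENNReal.add_le_add_iff_left (by simp [ENNReal.div_eq_top, hδfin])).1 h4

end

end RenewalEquation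

/-! ### The random walk embedded at the claim times -/

namespace RiskModel

noncomputable section

open KilledWalk

/-- The increment of the reserve between two consecutive claims. -/
def increment (M : RiskModel.{v}) (i : ℕ) (ω : M.Ω) : ℝ := M.c * M.W i ω - M.Z i ω

/-- The law of the increments of the reserve between consecutive claims. -/
def incrementLaw (M : RiskModel.{v}) : Measure ℝ := M.P.map (M.increment 0)

variable (M : RiskModel.{v})

lemma measurable_increment (i : ℕ) : Measurable (M.increment i) :=
  ((M.measurable_W i).const_mul _).sub (M.measurable_Z i)

lemma measurable_sumElim (x : ℕ ⊕ ℕ) : Measurable (Sum.elim M.W M.Z x) := by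
  cases x with
  | inl i => exact M.measurable_W i
  | inr i => exact M.measurable_Z i

instance : IsProbabilityMeasure M.incrementLaw :=
  Measure.isProbabilityMeasure_map (M.measurable_increment 0).aemeasurable

instance : IsProbabilityMeasure M.claimLaw :=
  Measure.isProbabilityMeasure_map (M.measurable_Z 0).aemeasurable

lemma indepFun_W_Z (i l : ℕ) : IndepFun (M.W i) (M.Z l) M.P :=
  M.indep.indepFun (i := Sum.inl i) (j := Sum.inr l) (by simp)

lemma map_increment (i : ℕ) : M.P.map (M.increment i) = M.incrementLaw := by
  have h : ∀ l, M.P.map (M.increment l) =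
      ((expMeasure M.lam).prod M.claimLaw).map fun p => M.c * p.1 - p.2 := by
    intro l
    have h1 := (indepFun_iff_map_prod_eq_prod_map_map (M.measurable_W l).aemeasurable
      (M.measurable_Z l).aemeasurable).1 (M.indepFun_W_Z l l)
    rw [M.law_W, M.law_Z] at h1
    rw [claimLaw, ← h1, Measure.map_map (by fun_prop)
      ((M.measurable_W l).prodMk (M.measurable_Z l))]
    rfl
  rw [incrementLaw, h i, h 0]

/-- The past increments and the next one are functions of disjoint subfamilies of the independent
family of all `W i` and `Z i`. -/
lemma indepFun_increment (n : ℕ) :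
    IndepFun (fun ω (i : Finset.range (n + 1)) => M.increment i ω) (M.increment (n + 1)) M.P := by
  have h := M.indep.indepFun_finset ((Finset.range (n + 1)).disjSum (Finset.range (n + 1)))
    {Sum.inl (n + 1), Sum.inr (n + 1)} (by
      rw [Finset.disjoint_left]
      rintro (a | a) ha hb
      · simp at ha hb; omega
      · simp at ha hb; omega) M.measurable_sumElim
  have h1 : Measurable fun (y : (Finset.range (n + 1)).disjSum (Finset.range (n + 1)) → ℝ)
      (i : Finset.range (n + 1)) => M.c * y ⟨Sum.inl i, by simp⟩ -
        y ⟨Sum.inr i, by simp⟩ := by fun_prop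
  have h2 : Measurable fun y : ({Sum.inl (n + 1), Sum.inr (n + 1)} : Finset (ℕ ⊕ ℕ)) → ℝ =>
      M.c * y ⟨Sum.inl (n + 1), by simp⟩ - y ⟨Sum.inr (n + 1), by simp⟩ := by fun_prop
  exact h.comp h1 h2

lemma lintegral_expMeasure {r : ℝ} {g : ℝ → ℝ≥0∞} (hg : Measurable g) :
    ∫⁻ t, g t ∂(expMeasure r) =
      ∫⁻ t in Ioi 0, ENNReal.ofReal (r * Real.exp (-(r * t))) * g t := by
  have h : expMeasure r = volume.withDensity (exponentialPDF r) := rfl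
  have hm : Measurable (exponentialPDF r) := (measurable_exponentialPDFReal r).ennreal_ofReal
  rw [h, lintegral_withDensity_eq_lintegral_mul _ hm hg, restrict_Ioi_eq_restrict_Ici,
    ← lintegral_indicator measurableSet_Ici]
  refine lintegral_congr fun t => ?_
  by_cases ht : 0 ≤ t
  · simp [indicator_of_mem (show t ∈ Ici (0 : ℝ) from ht), exponentialPDF_of_nonneg ht]
  · simp [ht, exponentialPDF_of_neg (lt_of_not_ge ht)]

lemma lintegral_comp_mul_left {c : ℝ} (hc : 0 < c) {g : ℝ → ℝ≥0∞} (hg : Measurable g) :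
    ∫⁻ x, g x = ENNReal.ofReal c * ∫⁻ x, g (c * x) := by
  conv_lhs => rw [← Real.smul_map_volume_mul_left hc.ne']
  rw [lintegral_smul_measure, lintegral_map hg (by fun_prop), abs_of_pos hc, smul_eq_mul]

/-- The premium `c W` earned up to a claim is exponential of rate `λ / c`; the variable `s` of
`expStepMean` is the level `u + c W` just before the claim. -/
lemma stepMean_incrementLaw {f : ℝ → ℝ≥0∞} (hf : Measurable f) (u : ℝ) :
    stepMean M.incrementLaw f u = expStepMean (M.lam / M.c) M.claimLaw f u := by
  have hJ := measurable_jumpMean (F := M.claimLaw) hf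
  unfold stepMean incrementLaw expStepMean
  rw [lintegral_map (by fun_prop) (M.measurable_increment 0)]
  have h1 := lintegral_comp_of_indepFun (g := fun p : ℝ × ℝ => f (u + (M.c * p.1 - p.2)))
    (M.measurable_W 0) (M.measurable_Z 0) (M.indepFun_W_Z 0 0) (by fun_prop)
  simp only [increment]
  rw [h1]
  have h2 : ∀ w, ∫⁻ z, f (u + (M.c * w - z)) ∂(M.P.map (M.Z 0)) =
      (fun s => ∫⁻ z, f (s - z) ∂M.claimLaw) (u + M.c * w) := by
    intro w
    simp only [add_sub_assoc, claimLaw]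
  simp only [h2]
  set J : ℝ → ℝ≥0∞ := fun s => ∫⁻ z, f (s - z) ∂M.claimLaw
  have hJ' : Measurable fun w => J (u + M.c * w) := hJ.comp (by fun_prop)
  rw [← lintegral_map hJ' (M.measurable_W 0), M.law_W, lintegral_expMeasure hJ']
  have hm : Measurable fun x => (Ioi u).indicator (fun s =>
      ENNReal.ofReal (M.lam / M.c * Real.exp (-(M.lam / M.c * (s - u)))) * J s) (x + u) :=
    (Measurable.indicator (by fun_prop) measurableSet_Ioi).comp (measurable_add_const u)
  have h4 := lintegral_comp_mul_left M.c_pos hm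
  rw [lintegral_add_right_eq_self ((Ioi u).indicator _) u, lintegral_indicator measurableSet_Ioi]
    at h4
  rw [h4, ← lintegral_indicator measurableSet_Ioi, ← lintegral_const_mul' _ _ ENNReal.ofReal_ne_top]
  · refine lintegral_congr fun x => ?_
    by_cases hx : 0 < x
    · have h3 : M.c * x + u ∈ Ioi u := by
        simpa using mul_pos M.c_pos hx
      rw [indicator_of_mem (show x ∈ Ioi (0 : ℝ) from hx), indicator_of_mem h3, ← mul_assoc,
        ← ENNReal.ofReal_mul M.c_pos.le, add_comm u (M.c * x)]
      have := M.c_pos.ne'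
      have e1 : M.lam / M.c * (M.c * x + u - u) = M.lam * x := by
        rw [add_sub_cancel_right]; field_simp
      rw [e1]
      congr 2
      field_simp
    · have h3 : M.c * x + u ∉ Ioi u := by
        simpa using mul_nonpos_of_nonneg_of_nonpos M.c_pos.le (not_lt.1 hx)
      simp only [indicator_of_notMem (show x ∉ Ioi (0 : ℝ) from hx), indicator_of_notMem h3,
        mul_zero]

lemma claimLaw_Iic_zero : M.claimLaw (Iic 0) = 0 := by
  rw [claimLaw, Measure.map_apply (M.measurable_Z 0) measurableSet_Iic]
  have := M.Z_pos 0
  rw [ae_iff] at this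
  simpa [preimage, not_lt] using this

lemma claimLaw_Ioi (x : ℝ) : M.claimLaw (Ioi x) = ENNReal.ofReal (M.survival x) := by
  rw [claimLaw, Measure.map_apply (M.measurable_Z 0) measurableSet_Ioi, survival, ofReal_measureReal]
  rfl

end

end RiskModel

/-! ### Lundberg's inequality and the renewal equation for the deficit -/

namespace RiskModel

noncomputable section

open KilledWalk

/-- The `j`-th power of the deficit of a negative position. -/
def deficitPow (j : ℕ) (x : ℝ) : ℝ≥0∞ := (Iio 0).indicator (fun x => ENNReal.ofReal ((-x) ^ j)) x

lemma measurable_deficitPow (j : ℕ) : Measurable (deficitPow j) :=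
  Measurable.indicator (by fun_prop) measurableSet_Iio

lemma deficitPow_of_nonneg (j : ℕ) (x : ℝ) (hx : 0 ≤ x) : deficitPow j x = 0 :=
  indicator_of_notMem (by simpa using hx) _

lemma deficitPow_of_neg (j : ℕ) {x : ℝ} (hx : x < 0) :
    deficitPow j x = ENNReal.ofReal ((-x) ^ j) :=
  indicator_of_mem (by simpa using hx) _

variable (M : RiskModel.{v}) {R : ℝ}

/-- The `j`-th moment of the deficit on the event of ruin, as a functional of the random walk
embedded at the claim times. -/
def ruinMoment (j : ℕ) (u : ℝ) : ℝ≥0∞ :=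
  stepMean M.incrementLaw (exitValue M.incrementLaw (deficitPow j)) u

/-- The number of claims per unit of premium. -/
def claimRate : ℝ := M.lam / M.c

/-- The density of the exponentially tilted integrated tail distribution. -/
def tiltedDensity (R x : ℝ) : ℝ≥0∞ :=
  ENNReal.ofReal (M.claimRate * Real.exp (R * x)) * M.claimLaw (Ioi x)

lemma claimRate_pos : 0 < M.claimRate := div_pos M.lam_pos M.c_pos

lemma measurable_tiltedDensity (R : ℝ) : Measurable (M.tiltedDensity R) :=
  Measurable.mul (by fun_prop) measurable_meas_Ioi

lemma measurable_ruinMoment (j : ℕ) : Measurable (M.ruinMoment j) :=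
  measurable_stepMean (measurable_exitValue (measurable_deficitPow j))

lemma ae_claimLaw_pos : ∀ᵐ z ∂M.claimLaw, 0 < z := by
  rw [ae_iff]
  convert M.claimLaw_Iic_zero using 2
  ext z
  simp

lemma integral_claimLaw (j : ℕ) : ∫ z, z ^ j ∂M.claimLaw = M.moment j :=
  integral_map (M.measurable_Z 0).aemeasurable (by fun_prop)

lemma moment_nonneg (j : ℕ) : 0 ≤ M.moment j := by
  refine integral_nonneg_of_ae ?_
  filter_upwards [M.Z_pos 0] with ω hω
  exact pow_nonneg hω.le j

lemma survival_nonneg (x : ℝ) : 0 ≤ M.survival x := measureReal_nonneg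

lemma survival_pos (x : ℝ) : 0 < M.survival x :=
  ENNReal.toReal_pos (M.unbounded_support x).ne' (measure_ne_top _ _)

lemma antitone_survival : Antitone M.survival := fun _ _ h =>
  measureReal_mono fun _ hω => lt_of_le_of_lt h hω

namespace IsAdjustmentCoeff

variable {M}

lemma moment_one_pos (h : M.IsAdjustmentCoeff R) : 0 < M.moment 1 := by
  refine (M.moment_nonneg 1).lt_of_ne fun h0 => ?_
  have := h.2
  simp [tailDensity, ← h0] at this

end IsAdjustmentCoeff

variable {M}

lemma tailDensity_div (h : 0 < M.moment 1) (x : ℝ) :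
    M.tailDensity x / (1 + M.loading) = M.claimRate * M.survival x := by
  have h1 := M.lam_pos.ne'
  have h2 := M.c_pos.ne'
  have h3 := h.ne'
  rw [tailDensity, loading, claimRate, add_sub_cancel]
  field_simp

lemma ofReal_tailDensity_div (h : 0 < M.moment 1) (R x : ℝ) :
    ENNReal.ofReal (Real.exp (R * x) * (M.tailDensity x / (1 + M.loading))) =
      M.tiltedDensity R x := by
  have := M.claimRate_pos
  rw [tailDensity_div h, tiltedDensity, claimLaw_Ioi, ← ENNReal.ofReal_mul (by positivity)]
  congr 1
  ring

lemma expMoment_eq (h : 0 < M.moment 1) (k : ℕ) (R : ℝ) :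
    M.expMoment k R = ∫⁻ x in Ioi 0, ENNReal.ofReal (x ^ k) * M.tiltedDensity R x := by
  refine setLIntegral_congr_fun measurableSet_Ioi fun x hx => ?_
  rw [mul_assoc, ENNReal.ofReal_mul (pow_nonneg (le_of_lt hx) k), ofReal_tailDensity_div h]

namespace IsAdjustmentCoeff

lemma lintegral_tiltedDensity (h : M.IsAdjustmentCoeff R) :
    ∫⁻ x in Ioi 0, M.tiltedDensity R x = 1 := by
  have hm := h.moment_one_pos
  have hi : IntegrableOn (fun x => Real.exp (R * x) * (M.tailDensity x / (1 + M.loading)))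
      (Ioi 0) := by
    by_contra hn
    have := h.2
    rw [integral_undef hn] at this
    exact zero_ne_one this
  simp_rw [← ofReal_tailDensity_div hm]
  rw [← ofReal_integral_eq_lintegral_ofReal hi, h.2, ENNReal.ofReal_one]
  refine Filter.Eventually.of_forall fun x => ?_
  simp only [tailDensity_div hm, Pi.zero_apply]
  exact mul_nonneg (Real.exp_pos _).le (mul_nonneg M.claimRate_pos.le (M.survival_nonneg x))

/-- Layer-cake formula for `e^{Rz} - 1`, the integral of `R e^{Rt}` over `[0, z]`: the result is `R
/ a` times the Lundberg integral, which is 1. -/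
lemma lintegral_exp_claim (h : M.IsAdjustmentCoeff R) :
    ∫⁻ z, ENNReal.ofReal (Real.exp (R * z)) ∂M.claimLaw =
      ENNReal.ofReal (1 + R / M.claimRate) := by
  have hR := h.1
  have ha := M.claimRate_pos
  have hd : ∀ z : ℝ, ∫ t in (0 : ℝ)..z, R * Real.exp (R * t) = Real.exp (R * z) - 1 := by
    intro z
    rw [intervalIntegral.integral_eq_sub_of_hasDerivAt (f := fun t => Real.exp (R * t))]
    · simp
    · intro x _
      simpa [mul_comm] using ((hasDerivAt_id' x).const_mul R).exp
    · exact Continuous.intervalIntegrable (by fun_prop) _ _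
  have hl := lintegral_comp_eq_lintegral_meas_lt_mul M.claimLaw (f := fun z => z)
    (g := fun t => R * Real.exp (R * t)) (by
      filter_upwards [M.ae_claimLaw_pos] with z hz using hz.le) (by fun_prop)
    (fun t _ => Continuous.intervalIntegrable (by fun_prop) _ _)
    (Filter.Eventually.of_forall fun t => by positivity)
  have h1 : ∫⁻ t in Ioi 0, M.claimLaw {z | t < z} * ENNReal.ofReal (R * Real.exp (R * t)) =
      ENNReal.ofReal (R / M.claimRate) := by
    rw [← mul_one (ENNReal.ofReal (R / M.claimRate)), ← h.lintegral_tiltedDensity,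
      ← lintegral_const_mul' _ _ ENNReal.ofReal_ne_top]
    refine lintegral_congr fun t => ?_
    rw [tiltedDensity, ← mul_assoc, ← ENNReal.ofReal_mul (by positivity), mul_comm]
    congr 2
    field_simp
  rw [h1] at hl
  rw [ENNReal.ofReal_add zero_le_one (by positivity), ← hl, ENNReal.ofReal_one,
    ← measure_univ (μ := M.claimLaw), ← lintegral_one, ← lintegral_add_left measurable_const]
  refine lintegral_congr_ae ?_
  filter_upwards [M.ae_claimLaw_pos] with z hz
  rw [hd, ← ENNReal.ofReal_one, ← ENNReal.ofReal_add zero_le_one]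
  · simp
  · simp only [sub_nonneg, Real.one_le_exp_iff]; positivity

lemma integrable_exp_claim (h : M.IsAdjustmentCoeff R) :
    Integrable (fun z => Real.exp (R * z)) M.claimLaw := by
  refine ⟨by fun_prop, ?_⟩
  rw [hasFiniteIntegral_iff_ofReal (Filter.Eventually.of_forall fun z => (Real.exp_pos _).le),
    h.lintegral_exp_claim]
  exact ENNReal.ofReal_lt_top

lemma pow_le_exp (h : M.IsAdjustmentCoeff R) (j : ℕ) {x : ℝ} (hx : 0 ≤ x) :
    x ^ j ≤ j.factorial / R ^ j * Real.exp (R * x) := by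
  have hR := h.1
  have := Real.pow_div_factorial_le_exp (R * x) (mul_nonneg hR.le hx) j
  rw [div_le_iff₀ (by positivity), mul_pow] at this
  rw [div_mul_eq_mul_div, le_div_iff₀ (by positivity)]
  linarith

lemma integrable_pow_claim (h : M.IsAdjustmentCoeff R) (j : ℕ) :
    Integrable (fun z => z ^ j) M.claimLaw := by
  refine (h.integrable_exp_claim.const_mul (j.factorial / R ^ j)).mono' (by fun_prop) ?_
  filter_upwards [M.ae_claimLaw_pos] with z hz
  rw [Real.norm_of_nonneg (pow_nonneg hz.le j)]
  exact h.pow_le_exp j hz.le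

lemma moment_pos (h : M.IsAdjustmentCoeff R) (j : ℕ) : 0 < M.moment j := by
  rw [← integral_claimLaw, integral_pos_iff_support_of_nonneg_ae _ (h.integrable_pow_claim j)]
  · have : M.claimLaw (Ioi 0) ≤ M.claimLaw (Function.support fun z : ℝ => z ^ j) :=
      measure_mono fun z hz => (pow_pos hz j).ne'
    refine lt_of_lt_of_le ?_ this
    rw [claimLaw_Ioi]
    exact ENNReal.ofReal_pos.2 (M.survival_pos 0)
  · filter_upwards [M.ae_claimLaw_pos] with z hz using pow_nonneg hz.le j

lemma lintegral_pow_mul_tail (h : M.IsAdjustmentCoeff R) (j : ℕ) :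
    ∫⁻ x in Ioi 0, ENNReal.ofReal (x ^ j) * M.claimLaw (Ioi x) =
      ENNReal.ofReal (M.moment (j + 1) / (j + 1)) := by
  have hl := lintegral_comp_eq_lintegral_meas_lt_mul M.claimLaw (f := fun z => z)
    (g := fun t => t ^ j) (by
      filter_upwards [M.ae_claimLaw_pos] with z hz using hz.le) (by fun_prop)
    (fun t _ => Continuous.intervalIntegrable (by fun_prop) _ _)
    ((ae_restrict_iff' measurableSet_Ioi).2
      (Filter.Eventually.of_forall fun t ht => pow_nonneg (le_of_lt ht) j))
  calc _ = ∫⁻ t in Ioi 0, M.claimLaw {z | t < z} * ENNReal.ofReal (t ^ j) :=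
        lintegral_congr fun t => mul_comm _ _
    _ = _ := by
        rw [← hl, ← integral_claimLaw, ← integral_div,
          ofReal_integral_eq_lintegral_ofReal ((h.integrable_pow_claim _).div_const _)]
        · refine lintegral_congr fun z => ?_
          simp
        · filter_upwards [M.ae_claimLaw_pos] with z hz
          exact div_nonneg (pow_nonneg hz.le _) (by positivity)

/-- The process `e^{-R U}` is a martingale along the walk: the claim contributes `1 + R / a`, the
exponential move `a / (a + R)`. The second factor appears through the normalisation of the
exponential density of rate `a + R`. -/
lemma stepMean_exp (h : M.IsAdjustmentCoeff R) {C : ℝ} (hC : 0 ≤ C) (u : ℝ) :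
    stepMean M.incrementLaw (fun x => ENNReal.ofReal (C * Real.exp (-(R * x)))) u =
      ENNReal.ofReal (C * Real.exp (-(R * u))) := by
  have hR := h.1
  have ha := M.claimRate_pos
  set a := M.claimRate with hadef
  rw [stepMean_incrementLaw M (by fun_prop), expStepMean]
  have h1 : ∀ s, ∫⁻ z, ENNReal.ofReal (C * Real.exp (-(R * (s - z)))) ∂M.claimLaw =
      ENNReal.ofReal (C * Real.exp (-(R * s)) * (1 + R / a)) := by
    intro s
    rw [ENNReal.ofReal_mul (by positivity), ← h.lintegral_exp_claim,
      ← lintegral_const_mul' _ _ ENNReal.ofReal_ne_top]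
    refine lintegral_congr fun z => ?_
    rw [← ENNReal.ofReal_mul (by positivity), mul_assoc, ← Real.exp_add]
    ring_nf
  simp_rw [h1]
  have h2 : ∫⁻ s in Ioi u, ENNReal.ofReal ((a + R) * Real.exp (-((a + R) * (s - u)))) = 1 := by
    have h3 := lintegral_expMeasure (r := a + R) (g := fun _ => 1) measurable_const
    have := isProbabilityMeasure_expMeasure (r := a + R) (by positivity)
    simp only [mul_one, lintegral_one, measure_univ] at h3
    rw [h3, ← lintegral_indicator measurableSet_Ioi, ← lintegral_indicator measurableSet_Ioi,
      ← lintegral_sub_right_eq_self ((Ioi 0).indicator _) u]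
    refine lintegral_congr fun s => ?_
    by_cases hs : u < s <;> simp [hs]
  rw [← mul_one (ENNReal.ofReal (C * Real.exp (-(R * u)))), ← h2,
    ← lintegral_const_mul' _ _ ENNReal.ofReal_ne_top]
  refine lintegral_congr fun s => ?_
  change ENNReal.ofReal (a * Real.exp (-(a * (s - u)))) * _ = _
  rw [← ENNReal.ofReal_mul (by positivity), ← ENNReal.ofReal_mul (by positivity)]
  congr 1
  have e : Real.exp (-(R * u)) * Real.exp (-((a + R) * (s - u))) =
      Real.exp (-(a * (s - u))) * Real.exp (-(R * s)) := by
    rw [← Real.exp_add, ← Real.exp_add]; ring_nf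
  have : a * (1 + R / a) = a + R := by field_simp
  calc _ = (a * (1 + R / a)) * C * (Real.exp (-(a * (s - u))) * Real.exp (-(R * s))) := by ring
    _ = _ := by rw [this, ← e]; ring

/-- Lundberg's inequality for the moments of the deficit. -/
lemma exitValue_le (h : M.IsAdjustmentCoeff R) (j : ℕ) (x : ℝ) :
    exitValue M.incrementLaw (deficitPow j) x ≤
      ENNReal.ofReal (j.factorial / R ^ j * Real.exp (-(R * x))) := by
  have hR := h.1
  -- The exponential is a supersolution because it is invariant under a step, and `j! / R^j` makes
  -- it dominate `(-x)^j` for `x < 0`.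
  refine KilledWalk.exitValue_le (measurable_deficitPow j) (deficitPow_of_nonneg j)
    (g := fun x => ENNReal.ofReal (j.factorial / R ^ j * Real.exp (-(R * x)))) ?_ ?_ x
  · intro x hx
    rw [deficitPow_of_neg j hx]
    refine ENNReal.ofReal_le_ofReal ?_
    have := h.pow_le_exp j (neg_nonneg.2 hx.le)
    rwa [mul_neg] at this
  · intro x _
    exact (h.stepMean_exp (by positivity) x).le

end IsAdjustmentCoeff

/-- The two functions differ below zero, where `exitValue` stops and records the deficit while
`ruinMoment` still takes a step. The step equation is therefore written with `exitValue` inside, and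
only its values on `[0, ∞)` are replaced. -/
lemma exitValue_eq_ruinMoment (j : ℕ) {u : ℝ} (hu : 0 ≤ u) :
    exitValue M.incrementLaw (deficitPow j) u = M.ruinMoment j u :=
  exitValue_of_nonneg (measurable_deficitPow j) (deficitPow_of_nonneg j) hu

lemma ruinMoment_eq_expStepMean (j : ℕ) (u : ℝ) :
    M.ruinMoment j u =
      expStepMean M.claimRate M.claimLaw (exitValue M.incrementLaw (deficitPow j)) u :=
  stepMean_incrementLaw M (measurable_exitValue (measurable_deficitPow j)) u

lemma IsAdjustmentCoeff.ruinMoment_le (h : M.IsAdjustmentCoeff R) (j : ℕ) {u : ℝ} (hu : 0 ≤ u) :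
    M.ruinMoment j u ≤ ENNReal.ofReal (j.factorial / R ^ j * Real.exp (-(R * u))) :=
  exitValue_eq_ruinMoment (M := M) j hu ▸ h.exitValue_le j u

lemma ruinMoment_le_mul (j : ℕ) {u v : ℝ} (huv : u ≤ v) :
    M.ruinMoment j v ≤
      ENNReal.ofReal (Real.exp (M.claimRate * (v - u))) * M.ruinMoment j u := by
  rw [ruinMoment_eq_expStepMean, ruinMoment_eq_expStepMean]
  exact expStepMean_le huv

/-- For a fixed claim `z`, the reflection `s ↦ u + z - s` preserves `(u, z)` and exchanges `z - s`
with `s - u`; integrating over `z` then leaves a tail of `F`. -/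
lemma lintegral_overshoot (F : Measure ℝ) [SFinite F] (j : ℕ) (u : ℝ) :
    ∫⁻ s in Ioi u, ∫⁻ z in Ioi s, deficitPow j (s - z) ∂F =
      ∫⁻ x in Ioi u, ENNReal.ofReal ((x - u) ^ j) * F (Ioi x) := by
  have hm1 : Measurable fun p : ℝ × ℝ => {p : ℝ × ℝ | p.1 < p.2}.indicator
      (fun p => ENNReal.ofReal ((p.2 - p.1) ^ j)) p :=
    Measurable.indicator (by fun_prop) (measurableSet_lt measurable_fst measurable_snd)
  have hm2 : Measurable fun p : ℝ × ℝ => {p : ℝ × ℝ | p.1 < p.2}.indicator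
      (fun p => ENNReal.ofReal ((p.1 - u) ^ j)) p :=
    Measurable.indicator (by fun_prop) (measurableSet_lt measurable_fst measurable_snd)
  calc ∫⁻ s in Ioi u, ∫⁻ z in Ioi s, deficitPow j (s - z) ∂F
      = ∫⁻ s in Ioi u, ∫⁻ z, (Ioi s).indicator (fun z => ENNReal.ofReal ((z - s) ^ j)) z ∂F := by
        refine lintegral_congr fun s => ?_
        rw [lintegral_indicator measurableSet_Ioi]
        refine setLIntegral_congr_fun measurableSet_Ioi fun z hz => ?_
        rw [deficitPow_of_neg j (sub_neg.2 hz), neg_sub]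
    _ = ∫⁻ z, (∫⁻ s in Ioi u, (Iio z).indicator (fun s => ENNReal.ofReal ((z - s) ^ j)) s) ∂F :=
        lintegral_lintegral_swap hm1.aemeasurable
    _ = ∫⁻ z, (∫⁻ x in Ioi u, (Iio z).indicator (fun x => ENNReal.ofReal ((x - u) ^ j)) x) ∂F := by
        refine lintegral_congr fun z => ?_
        rw [← lintegral_indicator measurableSet_Ioi, ← lintegral_indicator measurableSet_Ioi,
          ← lintegral_sub_left_eq_self _ (u + z)]
        refine lintegral_congr fun x => ?_
        have h1 : u + z - x ∈ Ioi u ↔ x ∈ Iio z := by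
          simp only [mem_Ioi, mem_Iio]; constructor <;> intro h <;> linarith
        have h2 : u + z - x ∈ Iio z ↔ x ∈ Ioi u := by
          simp only [mem_Ioi, mem_Iio]; constructor <;> intro h <;> linarith
        simp only [indicator_apply, h1, h2]
        rw [show z - (u + z - x) = x - u by ring]
        by_cases hx : x ∈ Iio z <;> by_cases hx' : x ∈ Ioi u <;> simp [hx, hx']
    _ = ∫⁻ x in Ioi u, ∫⁻ z, (Ioi x).indicator (fun _ => ENNReal.ofReal ((x - u) ^ j)) z ∂F :=
        (lintegral_lintegral_swap hm2.aemeasurable).symm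
    _ = _ := by
        refine lintegral_congr fun x => ?_
        rw [lintegral_indicator_const measurableSet_Ioi]

/-- The defective renewal equation for the moments of the deficit at ruin. -/
theorem IsAdjustmentCoeff.ruinMoment_renewal (h : M.IsAdjustmentCoeff R) (j : ℕ) {u : ℝ}
    (hu : 0 ≤ u) :
    M.ruinMoment j u = ENNReal.ofReal M.claimRate *
      ((∫⁻ v in Icc 0 u, M.ruinMoment j v * M.claimLaw (Ioi (u - v))) +
        ∫⁻ x in Ioi u, ENNReal.ofReal ((x - u) ^ j) * M.claimLaw (Ioi x)) := by
  have hfin : ∫⁻ v in Ioi u, exitValue M.incrementLaw (deficitPow j) v ≠ ∞ := by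
    refine ne_top_of_le_ne_top ?_ (lintegral_mono fun v => h.exitValue_le j v)
    have hi : IntegrableOn (fun x => j.factorial / R ^ j * Real.exp (-(R * x))) (Ioi u) := by
      have := (exp_neg_integrableOn_Ioi u h.1).const_mul (j.factorial / R ^ j)
      simpa only [neg_mul, IntegrableOn] using this
    exact hi.lintegral_lt_top.ne
  have hr := expStepMean_renewal M.claimRate_pos M.claimLaw_Iic_zero
    (measurable_exitValue (measurable_deficitPow j))
    (fun v hv => by rw [exitValue_eq_ruinMoment j hv, ruinMoment_eq_expStepMean]) hu hfin
  rw [exitValue_eq_ruinMoment j hu] at hr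
  rw [hr]
  congr 2
  · refine setLIntegral_congr_fun measurableSet_Icc fun v hv => ?_
    rw [exitValue_eq_ruinMoment j hv.1]
  · rw [← lintegral_overshoot]
    refine setLIntegral_congr_fun measurableSet_Ioi fun s _ => ?_
    refine setLIntegral_congr_fun measurableSet_Ioi fun z hz => ?_
    exact exitValue_of_neg (measurable_deficitPow j) (sub_neg.2 hz)

lemma IsAdjustmentCoeff.ruinMoment_zero (h : M.IsAdjustmentCoeff R) (j : ℕ) :
    M.ruinMoment j 0 = ENNReal.ofReal (M.claimRate * (M.moment (j + 1) / (j + 1))) := by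
  rw [h.ruinMoment_renewal j le_rfl, ENNReal.ofReal_mul M.claimRate_pos.le,
    ← h.lintegral_pow_mul_tail]
  simp

end

end RiskModel

/-! ### Tilted renewal equation and uniform two-sided bounds -/

namespace RiskModel

noncomputable section

open KilledWalk

variable {M : RiskModel.{v}} {R : ℝ}

lemma intervalIntegrable_survival (x y : ℝ) : IntervalIntegrable M.survival volume x y :=
  M.antitone_survival.intervalIntegrable

lemma tailDensity_pos (hm : 0 < M.moment 1) (x : ℝ) : 0 < M.tailDensity x :=
  div_pos (M.survival_pos x) hm

/-- In `ℝ≥0∞` a positive number divided by zero is `∞`, so a finite supremum also forces the tail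
survival to be positive. -/
lemma tailDensity_le_of_hazardSup_le (hm : 0 < M.moment 1) {H : ℝ≥0} (hH : M.hazardSup ≤ H)
    {x : ℝ} (hx : 0 ≤ x) : 0 < M.tailSurvival x ∧ M.tailDensity x ≤ H * M.tailSurvival x := by
  have h : ENNReal.ofReal (M.tailDensity x) / ENNReal.ofReal (M.tailSurvival x) ≤ H :=
    (le_iSup₂ (f := fun x (_ : x ∈ Ici (0 : ℝ)) =>
      ENNReal.ofReal (M.tailDensity x) / ENNReal.ofReal (M.tailSurvival x)) x hx).trans hH
  have hf := M.tailDensity_pos hm x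
  have hpos : 0 < M.tailSurvival x := by
    by_contra hn
    rw [ENNReal.ofReal_of_nonpos (not_lt.1 hn),
      ENNReal.div_zero (ENNReal.ofReal_pos.2 hf).ne'] at h
    exact absurd h (by simp)
  refine ⟨hpos, ?_⟩
  rw [ENNReal.div_le_iff (ENNReal.ofReal_pos.2 hpos).ne' ENNReal.ofReal_ne_top,
    ← ENNReal.ofReal_coe_nnreal, ← ENNReal.ofReal_mul (by positivity)] at h
  exact (ENNReal.ofReal_le_ofReal_iff (by positivity)).1 h

lemma tailSurvival_sub_le (hm : 0 < M.moment 1) {x y : ℝ} (hxy : x ≤ y) :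
    M.tailSurvival x - M.tailSurvival y ≤ (y - x) * M.tailDensity x := by
  have h1 := intervalIntegral.integral_add_adjacent_intervals
    (intervalIntegrable_survival (M := M) 0 x) (intervalIntegrable_survival x y)
  have h2 : ∫ t in x..y, M.survival t ≤ (y - x) * M.survival x := by
    refine (intervalIntegral.integral_mono_on hxy (intervalIntegrable_survival x y)
      intervalIntegrable_const fun t ht => M.antitone_survival ht.1).trans (le_of_eq ?_)
    rw [intervalIntegral.integral_const, smul_eq_mul]
  unfold tailSurvival tailDensity
  rw [← h1]
  calc _ = (∫ t in x..y, M.survival t) / M.moment 1 := by ring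
    _ ≤ (y - x) * M.survival x / M.moment 1 := by gcongr
    _ = _ := by ring

/-- Discrete Grönwall argument: the density is decreasing and at most `H` times the survival, so a
step of length `2 / n` loses at most the fraction `2H / n ≤ 1 / 2`, and `n` steps reach the point 2.
-/
lemma le_tailSurvival_two (hm : 0 < M.moment 1) {H : ℝ≥0} (hH : M.hazardSup ≤ H) :
    (1 / 2 : ℝ) ^ (⌈4 * (H : ℝ)⌉₊ + 1) ≤ M.tailSurvival 2 := by
  set n := ⌈4 * (H : ℝ)⌉₊ + 1 with hn
  have hn0 : (0 : ℝ) < n := by positivity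
  have hnH : 4 * (H : ℝ) ≤ n := (Nat.le_ceil _).trans (by rw [hn]; push_cast; linarith)
  have key : ∀ i : ℕ, (1 / 2 : ℝ) ^ i ≤ M.tailSurvival (i * (2 / n)) := by
    intro i
    induction i with
    | zero => simp [tailSurvival]
    | succ i ih =>
      obtain ⟨h1, h2⟩ := tailDensity_le_of_hazardSup_le hm hH (x := i * (2 / n)) (by positivity)
      have h3 := tailSurvival_sub_le hm
        (show i * (2 / (n : ℝ)) ≤ (i + 1 : ℕ) * (2 / n) by gcongr; omega)
      have h4 : ((i + 1 : ℕ) * (2 / (n : ℝ)) - i * (2 / n)) * M.tailDensity (i * (2 / n)) ≤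
          1 / 2 * M.tailSurvival (i * (2 / n)) := by
        have e : ((i + 1 : ℕ) * (2 / (n : ℝ)) - i * (2 / n)) = 2 / n := by push_cast; ring
        rw [e]
        calc _ ≤ 2 / n * (H * M.tailSurvival (i * (2 / n))) := by gcongr
          _ = (2 * H / n) * M.tailSurvival (i * (2 / n)) := by ring
          _ ≤ _ := by
            refine mul_le_mul_of_nonneg_right ?_ h1.le
            rw [div_le_iff₀ hn0]
            linarith
      rw [pow_succ]
      linarith
  have := key n
  rwa [mul_div_cancel₀ _ hn0.ne'] at this

namespace IsAdjustmentCoeff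

lemma lintegral_tail (h : M.IsAdjustmentCoeff R) {x : ℝ} (hx : 0 ≤ x) :
    ∫⁻ y in Ioi x, M.claimLaw (Ioi y) = ENNReal.ofReal (M.moment 1 * M.tailSurvival x) := by
  have hm := h.moment_one_pos
  have h0 := h.lintegral_pow_mul_tail 0
  simp only [pow_zero, ENNReal.ofReal_one, one_mul, zero_add, Nat.cast_zero, div_one] at h0
  have h1 : ∫⁻ y in Ioc 0 x, M.claimLaw (Ioi y) =
      ENNReal.ofReal (∫ y in (0 : ℝ)..x, M.survival y) := by
    rw [intervalIntegral.integral_of_le hx, ofReal_integral_eq_lintegral_ofReal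
      (intervalIntegrable_survival 0 x).1 (Filter.Eventually.of_forall M.survival_nonneg)]
    exact lintegral_congr fun y => M.claimLaw_Ioi y
  rw [← Ioc_union_Ioi_eq_Ioi hx, lintegral_union measurableSet_Ioi (Ioc_disjoint_Ioi le_rfl),
    h1, add_comm] at h0
  have e : M.moment 1 * M.tailSurvival x = M.moment 1 - ∫ y in (0 : ℝ)..x, M.survival y := by
    rw [tailSurvival]; field_simp
  rw [e, ENNReal.ofReal_sub _ (intervalIntegral.integral_nonneg hx fun y _ => M.survival_nonneg y),
    ← h0, ENNReal.add_sub_cancel_right ENNReal.ofReal_ne_top]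

lemma ofReal_le_lintegral_tail (h : M.IsAdjustmentCoeff R) {A : ℝ} (hA : 1 / M.claimRate ≤ A)
    {H : ℝ≥0} (hH : M.hazardSup ≤ H) :
    ENNReal.ofReal (M.moment 1 * (1 / 2) ^ (⌈4 * (H : ℝ)⌉₊ + 1) / A) ≤
      ENNReal.ofReal M.claimRate * ∫⁻ y in Ioi 2, M.claimLaw (Ioi y) := by
  have ha := M.claimRate_pos
  have hm := h.moment_one_pos
  have h2 := le_tailSurvival_two hm hH
  have hA0 : 0 < A := lt_of_lt_of_le (by positivity) hA
  rw [h.lintegral_tail zero_le_two, ← ENNReal.ofReal_mul ha.le]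
  refine ENNReal.ofReal_le_ofReal ?_
  have h3 : 1 / A ≤ M.claimRate := by
    rw [div_le_iff₀ ha] at hA
    rw [div_le_iff₀ hA0]
    linarith
  calc _ = 1 / A * (M.moment 1 * (1 / 2) ^ (⌈4 * (H : ℝ)⌉₊ + 1)) := by ring
    _ ≤ _ := by gcongr

/-- Without the tilt, `a G` has mass `a m_1`; the tilt only increases it, and the tilted mass is 1.
-/
lemma claimRate_le (h : M.IsAdjustmentCoeff R) : M.claimRate ≤ 1 / M.moment 1 := by
  have ha := M.claimRate_pos
  have hm := h.moment_one_pos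
  have h0 := h.lintegral_pow_mul_tail 0
  simp only [pow_zero, ENNReal.ofReal_one, one_mul, zero_add, Nat.cast_zero, div_one] at h0
  have h1 : ENNReal.ofReal (M.claimRate * M.moment 1) ≤ ENNReal.ofReal 1 := by
    rw [ENNReal.ofReal_mul ha.le, ← h0, ← lintegral_const_mul' _ _ ENNReal.ofReal_ne_top,
      ENNReal.ofReal_one, ← h.lintegral_tiltedDensity]
    refine setLIntegral_mono (M.measurable_tiltedDensity R) fun x hx => ?_
    unfold tiltedDensity
    gcongr
    exact le_mul_of_one_le_right ha.le (Real.one_le_exp (mul_nonneg h.1.le (le_of_lt hx)))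
  rw [ENNReal.ofReal_le_ofReal_iff zero_le_one] at h1
  rwa [le_div_iff₀ hm]

/-- Serves twice: it bounds the tilted mass beyond 1 from below and, since that mass is at most 1,
it bounds `R` from above. -/
lemma exp_mul_lintegral_le (h : M.IsAdjustmentCoeff R) :
    ENNReal.ofReal (Real.exp R) * (ENNReal.ofReal M.claimRate *
      ∫⁻ y in Ioi 2, M.claimLaw (Ioi y)) ≤ ∫⁻ x in Ioi 1, M.tiltedDensity R x := by
  have ha := M.claimRate_pos
  rw [← mul_assoc, ← ENNReal.ofReal_mul (Real.exp_pos R).le,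
    ← lintegral_const_mul' _ _ ENNReal.ofReal_ne_top]
  refine (lintegral_mono_set (Ioi_subset_Ioi one_le_two)).trans ?_
  refine setLIntegral_mono (M.measurable_tiltedDensity R) fun x hx => ?_
  unfold tiltedDensity
  rw [mul_comm (Real.exp R)]
  gcongr
  exact le_mul_of_one_le_right h.1.le (le_of_lt hx)

lemma lintegral_pow_mul_tiltedDensity_le (h : M.IsAdjustmentCoeff R) {k : ℕ} {K : ℝ≥0}
    (hK : M.expMoment k R ≤ K) {i : ℕ} (hi : i ≤ k) :
    ∫⁻ x in Ioi 0, ENNReal.ofReal (x ^ i) * M.tiltedDensity R x ≤ 1 + K := by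
  rw [expMoment_eq h.moment_one_pos] at hK
  rw [← h.lintegral_tiltedDensity]
  refine le_trans ?_ (add_le_add le_rfl hK)
  rw [← lintegral_add_left (M.measurable_tiltedDensity R)]
  refine setLIntegral_mono ((M.measurable_tiltedDensity R).add
    (Measurable.mul (by fun_prop) (M.measurable_tiltedDensity R))) fun x hx => ?_
  rw [← one_add_mul]
  gcongr
  have hx0 : (0 : ℝ) ≤ x := le_of_lt hx
  rw [← ENNReal.ofReal_one, ← ENNReal.ofReal_add zero_le_one (by positivity)]
  refine ENNReal.ofReal_le_ofReal ?_
  rcases le_total x 1 with h1 | h1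
  · linarith [pow_le_one₀ hx0 h1 (n := i), pow_nonneg hx0 k]
  · linarith [pow_le_pow_right₀ h1 hi]

end IsAdjustmentCoeff

lemma lintegral_lintegral_Ioi {g : ℝ → ℝ≥0∞} (hg : Measurable g) (c : ℝ) :
    ∫⁻ u in Ici c, ∫⁻ x in Ioi u, g x = ∫⁻ x in Ioi c, ENNReal.ofReal (x - c) * g x := by
  have hm : Measurable fun p : ℝ × ℝ => {p : ℝ × ℝ | p.1 < p.2}.indicator (fun p => g p.2) p :=
    Measurable.indicator (by fun_prop) (measurableSet_lt measurable_fst measurable_snd)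
  calc ∫⁻ u in Ici c, ∫⁻ x in Ioi u, g x
      = ∫⁻ u in Ici c, ∫⁻ x, (Ioi u).indicator g x := by
        refine lintegral_congr fun u => ?_
        rw [lintegral_indicator measurableSet_Ioi]
    _ = ∫⁻ x, ∫⁻ u in Ici c, (Iio x).indicator (fun _ => g x) u :=
        lintegral_lintegral_swap hm.aemeasurable
    _ = _ := by
        rw [← lintegral_indicator measurableSet_Ioi]
        refine lintegral_congr fun x => ?_
        rw [lintegral_indicator_const measurableSet_Iio, Measure.restrict_apply measurableSet_Iio,
          inter_comm, Ici_inter_Iio, Real.volume_Ico, mul_comm]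
        by_cases hx : c < x
        · simp [hx]
        · simp [hx, ENNReal.ofReal_of_nonpos (sub_nonpos.2 (not_lt.1 hx))]

/-- The moment of the deficit, exponentially tilted in the initial reserve. -/
def tiltedRuinMoment (M : RiskModel.{v}) (R : ℝ) (j : ℕ) (u : ℝ) : ℝ≥0∞ :=
  ENNReal.ofReal (Real.exp (R * u)) * M.ruinMoment j u

/-- The inhomogeneity of the renewal equation for `tiltedRuinMoment`. -/
def tiltedOvershoot (M : RiskModel.{v}) (R : ℝ) (j : ℕ) (u : ℝ) : ℝ≥0∞ :=
  ENNReal.ofReal (M.claimRate * Real.exp (R * u)) *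
    ∫⁻ x in Ioi u, ENNReal.ofReal ((x - u) ^ j) * M.claimLaw (Ioi x)

lemma measurable_tiltedRuinMoment (j : ℕ) : Measurable (M.tiltedRuinMoment R j) :=
  Measurable.mul (by fun_prop) (M.measurable_ruinMoment j)

lemma measurable_tiltedOvershoot (j : ℕ) : Measurable (M.tiltedOvershoot R j) := by
  refine Measurable.mul (by fun_prop) ?_
  have hF : Measurable fun p : ℝ × ℝ => M.claimLaw (Ioi p.2) :=
    measurable_meas_Ioi.comp measurable_snd
  have hm : Measurable fun p : ℝ × ℝ => {p : ℝ × ℝ | p.1 < p.2}.indicator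
      (fun p => ENNReal.ofReal ((p.2 - p.1) ^ j) * M.claimLaw (Ioi p.2)) p :=
    Measurable.indicator (Measurable.mul (by fun_prop) hF)
      (measurableSet_lt measurable_fst measurable_snd)
  have := hm.lintegral_prod_right' (ν := volume)
  simp_rw [← lintegral_indicator measurableSet_Ioi]
  exact this

lemma tiltedRuinMoment_le_mul (j : ℕ) {u v : ℝ} (huv : u ≤ v) :
    M.tiltedRuinMoment R j v ≤ ENNReal.ofReal (Real.exp ((M.claimRate + R) * (v - u))) *
      M.tiltedRuinMoment R j u := by
  refine (mul_le_mul_right (ruinMoment_le_mul j huv) _).trans (le_of_eq ?_)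
  rw [tiltedRuinMoment, ← mul_assoc, ← mul_assoc, ← ENNReal.ofReal_mul (by positivity),
    ← ENNReal.ofReal_mul (by positivity), ← Real.exp_add, ← Real.exp_add]
  ring_nf

namespace IsAdjustmentCoeff

lemma tiltedRuinMoment_eq (h : M.IsAdjustmentCoeff R) (j : ℕ) {u : ℝ} (hu : 0 ≤ u) :
    M.tiltedRuinMoment R j u =
      (∫⁻ v in Icc 0 u, M.tiltedRuinMoment R j v * M.tiltedDensity R (u - v)) +
        M.tiltedOvershoot R j u := by
  have ha := M.claimRate_pos
  rw [tiltedRuinMoment, h.ruinMoment_renewal j hu, ← mul_assoc,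
    ← ENNReal.ofReal_mul (Real.exp_pos _).le, mul_add, tiltedOvershoot, mul_comm M.claimRate]
  congr 1
  rw [← lintegral_const_mul' _ _ ENNReal.ofReal_ne_top]
  refine lintegral_congr fun v => ?_
  have e : Real.exp (R * u) = Real.exp (R * v) * Real.exp (R * (u - v)) := by
    rw [← Real.exp_add]; ring_nf
  rw [tiltedRuinMoment, tiltedDensity, e, ENNReal.ofReal_mul (by positivity),
    ENNReal.ofReal_mul (by positivity), ENNReal.ofReal_mul (by positivity)]
  ring

/-- This bound explodes as `R → 0` and serves only for local integrability; the uniform bounds come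
from the renewal equation. -/
lemma tiltedRuinMoment_le (h : M.IsAdjustmentCoeff R) (j : ℕ) {u : ℝ} (hu : 0 ≤ u) :
    M.tiltedRuinMoment R j u ≤ ENNReal.ofReal (j.factorial / R ^ j) := by
  have hR := h.1
  refine (mul_le_mul_right (h.ruinMoment_le j hu) _).trans (le_of_eq ?_)
  rw [← ENNReal.ofReal_mul (by positivity)]
  rw [mul_left_comm, ← Real.exp_add]
  simp

lemma lintegral_tiltedRuinMoment_ne_top (h : M.IsAdjustmentCoeff R) (j : ℕ) (t : ℝ) :
    ∫⁻ u in Icc 0 t, M.tiltedRuinMoment R j u ≠ ∞ := by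
  refine ne_top_of_le_ne_top ?_
    (setLIntegral_mono measurable_const fun u hu => h.tiltedRuinMoment_le j hu.1)
  rw [setLIntegral_const, Real.volume_Icc]
  exact ENNReal.mul_ne_top ENNReal.ofReal_ne_top ENNReal.ofReal_ne_top

lemma tiltedOvershoot_le (h : M.IsAdjustmentCoeff R) (j : ℕ) {u : ℝ} (hu : 0 ≤ u) :
    M.tiltedOvershoot R j u ≤ ∫⁻ x in Ioi u, ENNReal.ofReal (x ^ j) * M.tiltedDensity R x := by
  have ha := M.claimRate_pos
  rw [tiltedOvershoot, ← lintegral_const_mul' _ _ ENNReal.ofReal_ne_top]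
  refine setLIntegral_mono (Measurable.mul (by fun_prop) (M.measurable_tiltedDensity R))
    fun x hx => ?_
  rw [tiltedDensity, mul_left_comm]
  have hux : u < x := hx
  have := h.1.le
  gcongr
  linarith

lemma lintegral_tiltedOvershoot_le (h : M.IsAdjustmentCoeff R) (j : ℕ) :
    ∫⁻ u in Ici 0, M.tiltedOvershoot R j u ≤
      ∫⁻ x in Ioi 0, ENNReal.ofReal (x ^ (j + 1)) * M.tiltedDensity R x := by
  have hm : Measurable fun x => ENNReal.ofReal (x ^ j) * M.tiltedDensity R x :=
    Measurable.mul (by fun_prop) (M.measurable_tiltedDensity R)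
  calc _ ≤ ∫⁻ u in Ici 0, ∫⁻ x in Ioi u, ENNReal.ofReal (x ^ j) * M.tiltedDensity R x :=
        setLIntegral_mono' measurableSet_Ici fun u hu => h.tiltedOvershoot_le j hu
    _ = _ := by
        rw [lintegral_lintegral_Ioi hm]
        refine setLIntegral_congr_fun measurableSet_Ioi fun x hx => ?_
        have hx0 : (0 : ℝ) ≤ x := le_of_lt hx
        rw [← mul_assoc, ← ENNReal.ofReal_mul (by simpa using hx0), pow_succ', sub_zero]

/-- For `u ≤ 1` and `x > 2` one has `(x - u)^j ≥ 1`, so the tail beyond 2 is a lower bound for every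
`j`. -/
lemma le_tiltedOvershoot (h : M.IsAdjustmentCoeff R) (j : ℕ) :
    ENNReal.ofReal M.claimRate * ∫⁻ y in Ioi 2, M.claimLaw (Ioi y) ≤
      ∫⁻ u in Icc 0 1, M.tiltedOvershoot R j u := by
  have ha := M.claimRate_pos
  calc _ = ∫⁻ _ in Icc (0 : ℝ) 1,
        ENNReal.ofReal M.claimRate * ∫⁻ y in Ioi 2, M.claimLaw (Ioi y) := by simp
    _ ≤ _ := by
      refine setLIntegral_mono (measurable_tiltedOvershoot j) fun u hu => ?_
      unfold tiltedOvershoot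
      refine mul_le_mul' (ENNReal.ofReal_le_ofReal (le_mul_of_one_le_right ha.le
        (Real.one_le_exp (mul_nonneg h.1.le hu.1)))) ?_
      refine le_trans ?_ (lintegral_mono_set (Ioi_subset_Ioi (by linarith [hu.2] : u ≤ 2)))
      refine setLIntegral_mono' measurableSet_Ioi fun x hx => ?_
      have hx2 : (2 : ℝ) < x := hx
      refine le_mul_of_one_le_left' ?_
      rw [← ENNReal.ofReal_one]
      exact ENNReal.ofReal_le_ofReal (one_le_pow₀ (by linarith [hu.2]))

end IsAdjustmentCoeff

/-- By Tonelli the left side is the integral of `(x - ℓ) γ(x)` over `x > ℓ`, and there `x - ℓ ≤ x² /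
ℓ`. -/
lemma lintegral_tail_tiltedDensity_le {ℓ : ℝ} (hℓ : 0 < ℓ) :
    ∫⁻ x in Ici ℓ, ∫⁻ y in Ioi x, M.tiltedDensity R y ≤ ENNReal.ofReal (1 / ℓ) *
      ∫⁻ x in Ioi 0, ENNReal.ofReal (x ^ 2) * M.tiltedDensity R x := by
  rw [lintegral_lintegral_Ioi (M.measurable_tiltedDensity R),
    ← lintegral_const_mul' _ _ ENNReal.ofReal_ne_top]
  refine le_trans ?_ (lintegral_mono_set (Ioi_subset_Ioi hℓ.le))
  refine setLIntegral_mono (Measurable.const_mul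
    (Measurable.mul (by fun_prop) (M.measurable_tiltedDensity R)) _) fun x hx => ?_
  have hx : ℓ < x := hx
  rw [← mul_assoc, ← ENNReal.ofReal_mul (by positivity)]
  gcongr
  rw [one_div, inv_mul_eq_div, le_div_iff₀ hℓ]
  nlinarith

/-- The tilted moments of the deficit are bounded above and below, uniformly in the model. -/
theorem exists_tiltedRuinMoment_bounds {j k : ℕ} (hk : 2 ≤ k) (hj : j + 1 ≤ k) {m₁ : ℝ}
    (hm₁ : 0 < m₁) {A : ℝ} (hA : 0 < A) (K H : ℝ≥0) :
    ∃ b B : ℝ, 0 < b ∧ 0 < B ∧ ∀ (M : RiskModel.{v}) (R : ℝ), M.IsAdjustmentCoeff R →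
      M.moment 1 = m₁ → 1 / M.claimRate ≤ A → M.expMoment k R ≤ K → M.hazardSup ≤ H →
      ∀ u, 0 ≤ u → ENNReal.ofReal b ≤ M.tiltedRuinMoment R j u ∧
        M.tiltedRuinMoment R j u ≤ ENNReal.ofReal B := by
  -- Here `d` bounds from below `a` times the integral of the claim tail beyond 2, and so also the
  -- tilted mass beyond 1 and the inhomogeneity on `[0, 1]`. Next, `β` bounds the growth exponent `a
  -- + R`, since `a ≤ 1 / m₁` and `e^R d ≤ 1`. Then `B` is the bound of `mul_solution_le`, both
  -- summands there being at most `1 + K`, and `ℓ` makes the tail term in `le_mul_solution` at most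
  -- `d / 2`.
  set d : ℝ := m₁ * (1 / 2) ^ (⌈4 * (H : ℝ)⌉₊ + 1) / A with hd
  have hd0 : 0 < d := by positivity
  set β : ℝ := 1 / m₁ + Real.log (1 / d) with hβ
  set B : ℝ := Real.exp β * (2 * (1 + K)) / d with hB
  have hB0 : 0 < B := by positivity
  set ℓ : ℝ := max 1 (2 * B * (1 + K) / d) with hℓ
  have hℓ1 : 1 ≤ ℓ := le_max_left _ _
  have hℓ0 : 0 < ℓ := by linarith
  refine ⟨d / 2 / (ℓ * Real.exp (β * ℓ)), B, by positivity, hB0, ?_⟩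
  intro M R h hM hrate hK hH u hu
  have ha := M.claimRate_pos
  have hdle : ENNReal.ofReal d ≤ ENNReal.ofReal M.claimRate *
      ∫⁻ y in Ioi 2, M.claimLaw (Ioi y) := by
    have := h.ofReal_le_lintegral_tail hrate hH
    rwa [hM] at this
  have hexp : Real.exp R * d ≤ 1 := by
    have h1 : ENNReal.ofReal (Real.exp R * d) ≤ ENNReal.ofReal 1 := by
      rw [ENNReal.ofReal_mul (Real.exp_pos R).le, ENNReal.ofReal_one]
      exact (mul_le_mul_right hdle _).trans (h.exp_mul_lintegral_le.trans
        (RenewalEquation.tail_le_one h.lintegral_tiltedDensity zero_le_one))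
    exact (ENNReal.ofReal_le_ofReal_iff zero_le_one).1 h1
  have hRβ : M.claimRate + R ≤ β := by
    have h1 := h.claimRate_le
    rw [hM] at h1
    have h2 : R ≤ Real.log (1 / d) := by
      rw [Real.le_log_iff_exp_le (by positivity), le_div_iff₀ hd0]
      exact hexp
    linarith
  have hb0 : 0 ≤ M.claimRate + R := by linarith [h.1]
  have hd1 : ENNReal.ofReal d ≤ ∫⁻ x in Ioi 1, M.tiltedDensity R x :=
    (hdle.trans (le_mul_of_one_le_left' (by
      rw [← ENNReal.ofReal_one]
      exact ENNReal.ofReal_le_ofReal (Real.one_le_exp h.1.le)))).trans h.exp_mul_lintegral_le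
  have hZm := measurable_tiltedRuinMoment (M := M) (R := R) j
  have hzm := measurable_tiltedOvershoot (M := M) (R := R) j
  have hγm := M.measurable_tiltedDensity R
  have hKr : (1 + K : ℝ≥0∞) = ENNReal.ofReal (1 + K) := by
    rw [ENNReal.ofReal_add zero_le_one K.coe_nonneg, ENNReal.ofReal_one, ENNReal.ofReal_coe_nnreal]
  have hupper : ∀ u, 0 ≤ u → M.tiltedRuinMoment R j u ≤ ENNReal.ofReal B := by
    intro u hu
    have h1 := RenewalEquation.mul_solution_le hZm hzm hγm
      (fun u hu => h.tiltedRuinMoment_eq j hu) h.lintegral_tiltedDensity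
      (h.lintegral_tiltedRuinMoment_ne_top j) hb0
      (fun u v _ huv => tiltedRuinMoment_le_mul j huv) hd1 hu
    have h2 := (h.lintegral_tiltedOvershoot_le j).trans
      (h.lintegral_pow_mul_tiltedDensity_le hK hj)
    have h3 := (h.tiltedOvershoot_le j le_rfl).trans
      (h.lintegral_pow_mul_tiltedDensity_le hK (by omega : j ≤ k))
    have h4 : ENNReal.ofReal d * M.tiltedRuinMoment R j u ≤
        ENNReal.ofReal (Real.exp β * (2 * (1 + K))) := by
      refine h1.trans ?_
      rw [ENNReal.ofReal_mul (Real.exp_pos _).le]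
      refine mul_le_mul' (ENNReal.ofReal_le_ofReal (Real.exp_le_exp.2 hRβ)) ?_
      refine (add_le_add h2 h3).trans (le_of_eq ?_)
      rw [hKr, ← ENNReal.ofReal_add (by positivity) (by positivity)]
      ring_nf
    rw [hB, ENNReal.ofReal_div_of_pos hd0, ENNReal.le_div_iff_mul_le
      (Or.inl (ENNReal.ofReal_pos.2 hd0).ne') (Or.inl ENNReal.ofReal_ne_top), mul_comm]
    exact h4
  refine ⟨?_, hupper u hu⟩
  have htail : ENNReal.ofReal B * ∫⁻ x in Ici ℓ, ∫⁻ y in Ioi x, M.tiltedDensity R y ≤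
      ENNReal.ofReal d / 2 := by
    have h1 := (lintegral_tail_tiltedDensity_le hℓ0).trans
      (mul_le_mul_right (h.lintegral_pow_mul_tiltedDensity_le hK hk) _)
    refine (mul_le_mul_right h1 _).trans ?_
    rw [hKr, ← ENNReal.ofReal_mul (by positivity), ← ENNReal.ofReal_mul (by positivity),
      ← ENNReal.ofReal_ofNat 2, ← ENNReal.ofReal_div_of_pos two_pos]
    refine ENNReal.ofReal_le_ofReal ?_
    have h5 : 2 * B * (1 + K) / d ≤ ℓ := le_max_right _ _
    rw [div_le_iff₀ hd0] at h5
    rw [le_div_iff₀ two_pos]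
    calc B * (1 / ℓ * (1 + K)) * 2 = 2 * B * (1 + K) / ℓ := by ring
      _ ≤ d := by rw [div_le_iff₀ hℓ0]; linarith
  have h1 := RenewalEquation.le_mul_solution hZm hzm hγm
    (fun u hu => h.tiltedRuinMoment_eq j hu) h.lintegral_tiltedDensity
    (h.lintegral_tiltedRuinMoment_ne_top j) hb0
    (fun u v _ huv => tiltedRuinMoment_le_mul j huv) ENNReal.ofReal_ne_top
    (hdle.trans (h.le_tiltedOvershoot j)) hupper hℓ1 htail hu
  rw [ENNReal.ofReal_div_of_pos (by positivity)]
  refine ENNReal.div_le_of_le_mul' ?_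
  rw [ENNReal.ofReal_div_of_pos two_pos, ENNReal.ofReal_ofNat]
  refine h1.trans ?_
  gcongr

end

end RiskModel

/-! ### Sample paths: from the reserve process to the embedded walk -/

namespace RiskModel

noncomputable section

open KilledWalk

variable {M : RiskModel.{v}} {R : ℝ}

lemma expMeasure_Iic {r : ℝ} (hr : 0 < r) {t : ℝ} (ht : 0 ≤ t) :
    expMeasure r (Iic t) = ENNReal.ofReal (1 - Real.exp (-(r * t))) := by
  have := isProbabilityMeasure_expMeasure hr
  rw [← ofReal_cdf, cdf_expMeasure_eq hr, if_pos ht]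

lemma lintegral_prod_W_mul_prod_Z (M : RiskModel.{v}) {f g : ℝ → ℝ≥0∞} (hf : Measurable f)
    (hg : Measurable g) (n : ℕ) :
    ∫⁻ ω, (∏ i ∈ Finset.range n, f (M.W i ω)) * ∏ i ∈ Finset.range n, g (M.Z i ω) ∂M.P =
      (∫⁻ t, f t ∂(expMeasure M.lam)) ^ n * (∫⁻ z, g z ∂M.claimLaw) ^ n := by
  have hfg : ∀ x : ℕ ⊕ ℕ, Measurable (Sum.elim (fun _ => f) (fun _ => g) x : ℝ → ℝ≥0∞) := by
    rintro (i | i)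
    · exact hf
    · exact hg
  have h := lintegral_prod_eq_prod_lintegral_of_indepFun
    ((Finset.range n).disjSum (Finset.range n)) _
    (M.indep.comp (fun x => (Sum.elim (fun _ => f) (fun _ => g) x : ℝ → ℝ≥0∞)) hfg)
    (fun x => (hfg x).comp (M.measurable_sumElim x))
  simp only [Finset.prod_disjSum, Sum.elim_inl, Sum.elim_inr, Function.comp_apply] at h
  rw [h]
  congr 1
  · rw [Finset.prod_congr rfl fun i _ => show ∫⁻ ω, f (M.W i ω) ∂M.P =
      ∫⁻ t, f t ∂(expMeasure M.lam) by rw [← M.law_W i, lintegral_map hf (M.measurable_W i)]]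
    simp
  · rw [Finset.prod_congr rfl fun i _ => show ∫⁻ ω, g (M.Z i ω) ∂M.P =
      ∫⁻ z, g z ∂M.claimLaw by rw [claimLaw, ← M.law_Z i, lintegral_map hg (M.measurable_Z i)]]
    simp

lemma ae_W_pos (M : RiskModel.{v}) : ∀ᵐ ω ∂M.P, ∀ i, 0 < M.W i ω := by
  rw [ae_all_iff]
  intro i
  have h : expMeasure M.lam (Iic 0) = 0 := by
    rw [expMeasure_Iic M.lam_pos le_rfl]; simp
  rw [← M.law_W i, Measure.map_apply (M.measurable_W i) measurableSet_Iic] at h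
  rw [ae_iff]
  simpa [preimage, not_lt] using h

lemma measure_forall_W_le (M : RiskModel.{v}) {t : ℝ} (ht : 0 ≤ t) (n : ℕ) :
    M.P {ω | ∀ i < n, M.W i ω ≤ t} =
      ENNReal.ofReal (1 - Real.exp (-(M.lam * t))) ^ n := by
  have h := M.lintegral_prod_W_mul_prod_Z (f := (Iic t).indicator 1) (g := fun _ => 1)
    (measurable_one.indicator measurableSet_Iic) measurable_const n
  rw [lintegral_indicator_one measurableSet_Iic, expMeasure_Iic M.lam_pos ht] at h
  simp only [Finset.prod_const_one, mul_one, lintegral_one, measure_univ, one_pow] at h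
  rw [← h, ← lintegral_indicator_one]
  · refine lintegral_congr fun ω => ?_
    by_cases hω : ∀ i < n, M.W i ω ≤ t
    · rw [indicator_of_mem (by exact hω), Finset.prod_eq_one]
      · rfl
      · intro i hi
        simp [hω i (Finset.mem_range.1 hi)]
    · rw [indicator_of_notMem (by exact hω)]
      push Not at hω
      obtain ⟨i, hi, hlt⟩ := hω
      rw [Finset.prod_eq_zero (Finset.mem_range.2 hi)]
      simp [hlt]
  · have : {ω | ∀ i < n, M.W i ω ≤ t} = ⋂ i, ⋂ (_ : i < n), M.W i ⁻¹' Iic t := by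
      ext ω; simp
    rw [this]
    exact MeasurableSet.iInter fun i => MeasurableSet.iInter fun _ =>
      M.measurable_W i measurableSet_Iic

lemma W_le_of_arrival_le {ω : M.Ω} (hW : ∀ i, 0 < M.W i ω) {n : ℕ} {t : ℝ}
    (h : M.arrival n ω ≤ t) {i : ℕ} (hi : i ≤ n) : M.W i ω ≤ t :=
  (Finset.single_le_sum (f := fun i => M.W i ω) (fun i _ => (hW i).le)
    (Finset.mem_range.2 (Nat.lt_succ_of_le hi))).trans h

/-- If all arrivals stayed below `k`, all waiting times would be at most `k`, an event of
probability `lim p^n = 0` with `p < 1`. Excluding it matters for `count`: the `ncard` of an infinite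
set is 0. -/
lemma ae_exists_lt_arrival (M : RiskModel.{v}) :
    ∀ᵐ ω ∂M.P, ∀ t : ℝ, ∃ n, t < M.arrival n ω := by
  have h : ∀ k : ℕ, ∀ᵐ ω ∂M.P, ∃ n, (k : ℝ) < M.arrival n ω := by
    intro k
    have h0 : M.P {ω | ∀ i, M.W i ω ≤ k} = 0 := by
      have hlt : ENNReal.ofReal (1 - Real.exp (-(M.lam * k))) < 1 := by
        rw [← ENNReal.ofReal_one]
        exact (ENNReal.ofReal_lt_ofReal_iff one_pos).2 (by linarith [Real.exp_pos (-(M.lam * k))])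
      refine le_antisymm (ge_of_tendsto' (ENNReal.tendsto_pow_atTop_nhds_zero_of_lt_one hlt)
        fun n => ?_) zero_le
      rw [← M.measure_forall_W_le (Nat.cast_nonneg k)]
      exact measure_mono fun ω hω i _ => hω i
    filter_upwards [measure_eq_zero_iff_ae_notMem.1 h0, M.ae_W_pos] with ω hω hW
    by_contra hn
    push Not at hn
    exact hω fun i => W_le_of_arrival_le hW (hn i) le_rfl
  filter_upwards [ae_all_iff.2 h] with ω hω t
  obtain ⟨k, hk⟩ := exists_nat_gt t
  obtain ⟨n, hn⟩ := hω k
  exact ⟨n, hk.trans hn⟩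

/-- The path properties of the claim arrivals that hold almost surely. -/
def RegularPath (M : RiskModel.{v}) (ω : M.Ω) : Prop :=
  (∀ i, 0 < M.W i ω) ∧ ∀ t : ℝ, ∃ n, t < M.arrival n ω

lemma ae_regularPath (M : RiskModel.{v}) : ∀ᵐ ω ∂M.P, M.RegularPath ω := by
  filter_upwards [M.ae_W_pos, M.ae_exists_lt_arrival] with ω h1 h2 using ⟨h1, h2⟩

namespace RegularPath

variable {ω : M.Ω}

lemma strictMono_arrival (h : M.RegularPath ω) : StrictMono fun n => M.arrival n ω :=
  strictMono_nat_of_lt_succ fun n => by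
    simp only [arrival]
    rw [Finset.sum_range_succ _ (n + 1)]
    linarith [h.1 (n + 1)]

lemma arrival_nonneg (h : M.RegularPath ω) (n : ℕ) : 0 ≤ M.arrival n ω :=
  Finset.sum_nonneg fun i _ => (h.1 i).le

lemma count_eq {t : ℝ} {N : ℕ} (hN : ∀ n, M.arrival n ω ≤ t ↔ n < N) : M.count t ω = N := by
  have : {n : ℕ | M.arrival n ω ≤ t} = (Finset.range N : Finset ℕ) := by
    ext n; simp [hN]
  rw [count, this, ncard_coe_finset, Finset.card_range]

lemma arrival_le_iff_lt_count (h : M.RegularPath ω) (t : ℝ) (n : ℕ) : M.arrival n ω ≤ t ↔ n < M.count t ω := by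
  classical
  have hN : ∀ n, M.arrival n ω ≤ t ↔ n < Nat.find (h.2 t) := by
    intro n
    rw [Nat.lt_find_iff]
    constructor
    · exact fun hn m hm => not_lt.2 ((h.strictMono_arrival.monotone hm).trans hn)
    · exact fun hn => not_lt.1 (hn n le_rfl)
  rw [count_eq hN]
  exact hN n

lemma count_arrival (h : M.RegularPath ω) (n : ℕ) : M.count (M.arrival n ω) ω = n + 1 :=
  count_eq fun m => by
    rw [h.strictMono_arrival.le_iff_le (a := m) (b := n)]
    omega

lemma position_increment (u : ℝ) (n : ℕ) :
    position u (fun i => M.increment i ω) n =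
      u + M.c * M.arrival n ω - ∑ i ∈ Finset.range (n + 1), M.Z i ω := by
  simp only [position, increment, arrival, Finset.sum_sub_distrib, Finset.mul_sum]
  ring

lemma reserve_arrival (h : M.RegularPath ω) (u : ℝ) (n : ℕ) :
    M.reserve u (M.arrival n ω) ω = position u (fun i => M.increment i ω) n := by
  rw [position_increment, reserve, h.count_arrival]

/-- The reserve increases between claims, so if it is negative at `t` it was already negative at the
last claim before `t`; without a claim it is `u + c t ≥ 0`. -/
lemma exists_position_neg (h : M.RegularPath ω) {u t : ℝ} (hu : 0 ≤ u) (ht : 0 ≤ t) (hneg : M.reserve u t ω < 0) :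
    ∃ n, M.arrival n ω ≤ t ∧ position u (fun i => M.increment i ω) n < 0 := by
  rcases Nat.eq_zero_or_pos (M.count t ω) with h0 | h0
  · rw [reserve, h0] at hneg
    have := mul_nonneg M.c_pos.le ht
    simp at hneg
    linarith
  · obtain ⟨n, hn⟩ := Nat.exists_eq_add_of_lt h0
    rw [zero_add] at hn
    have hle : M.arrival n ω ≤ t := (h.arrival_le_iff_lt_count t n).2 (by omega)
    refine ⟨n, hle, ?_⟩
    rw [position_increment]
    rw [reserve, hn] at hneg
    have := mul_le_mul_of_nonneg_left hle M.c_pos.le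
    linarith

lemma ruinTime_eq (h : M.RegularPath ω) {u : ℝ} (hu : 0 ≤ u) {n : ℕ}
    (hlt : ∀ i < n, 0 ≤ position u (fun i => M.increment i ω) i)
    (hn : position u (fun i => M.increment i ω) n < 0) :
    M.ruinTime u ω = ENNReal.ofReal (M.arrival n ω) := by
  refine le_antisymm (iInf₂_le _ ⟨h.arrival_nonneg n, by rwa [h.reserve_arrival]⟩) ?_
  refine le_iInf₂ fun t ht => ?_
  obtain ⟨m, hm, hneg⟩ := h.exists_position_neg hu ht.1 ht.2
  refine ENNReal.ofReal_le_ofReal ((h.strictMono_arrival.monotone ?_).trans hm)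
  by_contra hmn
  exact absurd hneg (not_lt.2 (hlt m (not_le.1 hmn)))

lemma deficit_eq (h : M.RegularPath ω) {u : ℝ} (hu : 0 ≤ u) {n : ℕ}
    (hlt : ∀ i < n, 0 ≤ position u (fun i => M.increment i ω) i)
    (hn : position u (fun i => M.increment i ω) n < 0) :
    M.deficit u ω = -position u (fun i => M.increment i ω) n := by
  rw [deficit, h.ruinTime_eq hu hlt hn, ENNReal.toReal_ofReal (h.arrival_nonneg n),
    h.reserve_arrival, abs_of_neg hn]

lemma mem_ruin_iff (h : M.RegularPath ω) {u : ℝ} (hu : 0 ≤ u) :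
    ω ∈ M.ruin u ↔ ∃ n, position u (fun i => M.increment i ω) n < 0 := by
  classical
  constructor
  · intro hω
    by_contra hn
    have h0 : M.ruinTime u ω = ∞ := by
      refine iInf₂_eq_top.2 fun t ht => ?_
      obtain ⟨m, _, hneg⟩ := h.exists_position_neg hu ht.1 ht.2
      exact absurd ⟨m, hneg⟩ hn
    exact absurd h0 (ne_of_lt hω)
  · intro hex
    change M.ruinTime u ω < ∞
    rw [h.ruinTime_eq hu (fun i hi => not_lt.1 (Nat.find_min hex hi)) (Nat.find_spec hex)]
    exact ENNReal.ofReal_lt_top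

lemma indicator_ruin_deficit (h : M.RegularPath ω) {u : ℝ} (hu : 0 ≤ u) (j : ℕ) :
    (M.ruin u).indicator (fun ω => ENNReal.ofReal (M.deficit u ω ^ j)) ω =
      ∑' n, alive u (fun i => M.increment i ω) n *
        deficitPow j (position u (fun i => M.increment i ω) n) := by
  classical
  by_cases hex : ∃ n, position u (fun i => M.increment i ω) n < 0
  · have hlt : ∀ i < Nat.find hex, 0 ≤ position u (fun i => M.increment i ω) i :=
      fun i hi => not_lt.1 (Nat.find_min hex hi)
    rw [indicator_of_mem ((h.mem_ruin_iff hu).2 hex),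
      tsum_alive_mul_eq (deficitPow_of_nonneg j) hlt (Nat.find_spec hex),
      deficitPow_of_neg j (Nat.find_spec hex), h.deficit_eq hu hlt (Nat.find_spec hex)]
  · rw [indicator_of_notMem fun hω => hex ((h.mem_ruin_iff hu).1 hω),
      tsum_alive_mul_eq_zero (deficitPow_of_nonneg j)]
    push Not at hex
    exact hex

end RegularPath

variable (M)

lemma deficit_pow_nonneg (u : ℝ) (j : ℕ) (ω : M.Ω) : 0 ≤ M.deficit u ω ^ j :=
  pow_nonneg (abs_nonneg _) j

lemma measurable_exitFunctional (u : ℝ) (j : ℕ) :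
    Measurable fun ω => ∑' n, alive u (fun i => M.increment i ω) n *
        deficitPow j (position u (fun i => M.increment i ω) n) :=
  Measurable.tsum fun n =>
    ((measurable_alive u n).comp (measurable_pi_lambda _ M.measurable_increment)).mul
      ((measurable_deficitPow j).comp
        ((measurable_position u n).comp (measurable_pi_lambda _ M.measurable_increment)))

/-- `ruinTime` is an infimum over uncountably many times; on regular paths ruin is a countable union
of events of the walk. -/
lemma nullMeasurableSet_ruin {u : ℝ} (hu : 0 ≤ u) : NullMeasurableSet (M.ruin u) M.P := by
  have hm : MeasurableSet {ω | ∃ n, position u (fun i => M.increment i ω) n < 0} := by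
    have : {ω | ∃ n, position u (fun i => M.increment i ω) n < 0} =
        ⋃ n, {ω | position u (fun i => M.increment i ω) n < 0} := by ext ω; simp
    rw [this]
    exact MeasurableSet.iUnion fun n => measurableSet_lt
      ((measurable_position u n).comp (measurable_pi_lambda _ M.measurable_increment))
      measurable_const
  refine hm.nullMeasurableSet.congr ?_
  filter_upwards [M.ae_regularPath] with ω hω
  exact propext (hω.mem_ruin_iff hu).symm

/-- The bridge from the continuous-time process to the walk: on almost every path only the first
negative position contributes to the exit series. -/
lemma setLIntegral_ruin_deficit {u : ℝ} (hu : 0 ≤ u) (j : ℕ) :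
    ∫⁻ ω in M.ruin u, ENNReal.ofReal (M.deficit u ω ^ j) ∂M.P = M.ruinMoment j u := by
  rw [← lintegral_indicator₀ (M.nullMeasurableSet_ruin hu), ruinMoment,
    ← lintegral_tsum_alive_mul M.measurable_increment M.indepFun_increment M.map_increment
      (measurable_deficitPow j)]
  refine lintegral_congr_ae ?_
  filter_upwards [M.ae_regularPath] with ω hω using hω.indicator_ruin_deficit hu j

lemma measure_ruin {u : ℝ} (hu : 0 ≤ u) : M.P (M.ruin u) = M.ruinMoment 0 u := by
  rw [← M.setLIntegral_ruin_deficit hu 0]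
  simp

lemma aemeasurable_deficit_pow {u : ℝ} (hu : 0 ≤ u) (j : ℕ) :
    AEMeasurable (fun ω => M.deficit u ω ^ j) (ProbabilityTheory.cond M.P (M.ruin u)) := by
  refine AEMeasurable.smul_measure ?_ _
  refine ⟨_, (M.measurable_exitFunctional u j).ennreal_toReal, ?_⟩
  rw [Filter.EventuallyEq, ae_restrict_iff'₀ (M.nullMeasurableSet_ruin hu)]
  filter_upwards [M.ae_regularPath] with ω hω hr
  rw [← hω.indicator_ruin_deficit hu j, indicator_of_mem hr,
    ENNReal.toReal_ofReal (M.deficit_pow_nonneg u j ω)]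

lemma lintegral_cond_deficit {u : ℝ} (hu : 0 ≤ u) (j : ℕ) :
    ∫⁻ ω, ENNReal.ofReal (M.deficit u ω ^ j) ∂(ProbabilityTheory.cond M.P (M.ruin u)) =
      M.ruinMoment j u / M.ruinMoment 0 u := by
  rw [ProbabilityTheory.cond, lintegral_smul_measure, M.setLIntegral_ruin_deficit hu,
    M.measure_ruin hu, smul_eq_mul, mul_comm, div_eq_mul_inv]

lemma deficitMoment_eq {u : ℝ} (hu : 0 ≤ u) (j : ℕ) :
    M.deficitMoment j u = (M.ruinMoment j u / M.ruinMoment 0 u).toReal := by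
  rw [deficitMoment, integral_eq_lintegral_of_nonneg_ae
    (Filter.Eventually.of_forall (M.deficit_pow_nonneg u j))
    (M.aemeasurable_deficit_pow hu j).aestronglyMeasurable, M.lintegral_cond_deficit hu]

lemma integrable_deficit_pow {u : ℝ} (hu : 0 ≤ u) (j : ℕ)
    (hfin : M.ruinMoment j u / M.ruinMoment 0 u ≠ ∞) :
    Integrable (fun ω => M.deficit u ω ^ j) (ProbabilityTheory.cond M.P (M.ruin u)) := by
  refine ⟨(M.aemeasurable_deficit_pow hu j).aestronglyMeasurable, ?_⟩
  rw [hasFiniteIntegral_iff_ofReal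
    (Filter.Eventually.of_forall (M.deficit_pow_nonneg u j)),
    M.lintegral_cond_deficit hu]
  exact hfin.lt_top

end

end RiskModel

/-! ### Small-time moments of the reserve and moment matching -/

namespace RiskModel

noncomputable section

open Filter Topology

variable {M : RiskModel.{v}} {R : ℝ}

/-- The total claim amount until time `t`. -/
def claimSum (M : RiskModel.{v}) (t : ℝ) (ω : M.Ω) : ℝ :=
  ∑ i ∈ Finset.range (M.count t ω), M.Z i ω

/-- The reserve raised to the power `i` if all claims after the first one are disregarded. -/
def oneClaimPow (M : RiskModel.{v}) (i : ℕ) (t : ℝ) (ω : M.Ω) : ℝ :=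
  (M.c * t) ^ i + (Iic t).indicator 1 (M.W 0 ω) * ((M.c * t - M.Z 0 ω) ^ i - (M.c * t) ^ i)

lemma ae_Z_pos (M : RiskModel.{v}) : ∀ᵐ ω ∂M.P, ∀ i, 0 < M.Z i ω := ae_all_iff.2 M.Z_pos

lemma aemeasurable_claimSum (M : RiskModel.{v}) (t : ℝ) : AEMeasurable (M.claimSum t) M.P := by
  refine ⟨fun ω => (∑' n, (Iic t).indicator (1 : ℝ → ℝ≥0∞) (M.arrival n ω) *
    ENNReal.ofReal (M.Z n ω)).toReal, ?_, ?_⟩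
  · refine (Measurable.tsum fun n => ?_).ennreal_toReal
    have h1 : Measurable (M.arrival n) := Finset.measurable_fun_sum _ fun i _ => M.measurable_W i
    exact ((measurable_one.indicator measurableSet_Iic).comp h1).mul
      (M.measurable_Z n).ennreal_ofReal
  · filter_upwards [M.ae_regularPath, M.ae_Z_pos] with ω hω hZ
    rw [tsum_eq_sum (s := Finset.range (M.count t ω)), ENNReal.toReal_sum]
    · refine Finset.sum_congr rfl fun n hn => ?_
      rw [indicator_of_mem]
      · simp [ENNReal.toReal_ofReal (hZ n).le]
      · exact (hω.arrival_le_iff_lt_count t n).2 (Finset.mem_range.1 hn)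
    · intro n _
      exact ENNReal.mul_ne_top (by
        by_cases h : M.arrival n ω ≤ t <;> simp [h]) ENNReal.ofReal_ne_top
    · intro n hn
      rw [indicator_of_notMem, zero_mul]
      exact fun h' => hn (Finset.mem_range.2 ((hω.arrival_le_iff_lt_count t n).1 h'))

lemma aemeasurable_reserve (M : RiskModel.{v}) (u t : ℝ) : AEMeasurable (M.reserve u t) M.P :=
  (M.aemeasurable_claimSum t).const_sub (u + M.c * t)

lemma measurable_oneClaimPow (M : RiskModel.{v}) (i : ℕ) (t : ℝ) :
    Measurable (M.oneClaimPow i t) := by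
  have h1 : Measurable fun ω => (Iic t).indicator (1 : ℝ → ℝ) (M.W 0 ω) :=
    (measurable_one.indicator measurableSet_Iic).comp (M.measurable_W 0)
  have h2 := M.measurable_Z 0
  unfold oneClaimPow
  fun_prop

lemma IsAdjustmentCoeff.abs_sub_pow_le (h : M.IsAdjustmentCoeff R) (i : ℕ) {s x : ℝ} (hs : 0 ≤ s)
    (hx : 0 ≤ x) : |(s - x) ^ i| ≤ i.factorial / R ^ i * Real.exp (R * (s + x)) := by
  rw [abs_pow]
  refine le_trans ?_ (h.pow_le_exp i (add_nonneg hs hx))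
  exact pow_le_pow_left₀ (abs_nonneg _) (abs_le.2 ⟨by linarith, by linarith⟩) i

/-- With at most one claim before `t` the difference vanishes. With `n + 2` claims it is bounded by
an exponential of the claim sum, which is the term of index `n` of the series. The event is relaxed
to each waiting time being at most `t`, so that the factors become independent. -/
lemma RegularPath.abs_reserve_pow_sub_le {ω : M.Ω} (hω : M.RegularPath ω) (hZ : ∀ i, 0 < M.Z i ω)
    (h : M.IsAdjustmentCoeff R) (i : ℕ) {t : ℝ} (ht : 0 ≤ t) :
    ENNReal.ofReal |M.reserve 0 t ω ^ i - M.oneClaimPow i t ω| ≤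
      ENNReal.ofReal (2 * (i.factorial / R ^ i) * Real.exp (R * (M.c * t))) *
        ∑' n, (∏ l ∈ Finset.range (n + 2), (Iic t).indicator 1 (M.W l ω)) *
          ∏ l ∈ Finset.range (n + 2), ENNReal.ofReal (Real.exp (R * M.Z l ω)) := by
  have hR := h.1
  have hct : 0 ≤ M.c * t := mul_nonneg M.c_pos.le ht
  have hW0 : M.W 0 ω ≤ t ↔ 0 < M.count t ω := by
    rw [← hω.arrival_le_iff_lt_count t 0]; simp [arrival]
  rcases lt_or_ge (M.count t ω) 2 with h2 | h2
  · have h0 : M.reserve 0 t ω ^ i - M.oneClaimPow i t ω = 0 := by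
      have : M.count t ω = 0 ∨ M.count t ω = 1 := by omega
      rcases this with hc | hc
      · have : M.W 0 ω ∉ Iic t := by simp only [mem_Iic, hW0, hc]; simp
        simp [reserve, oneClaimPow, hc, indicator_of_notMem this]
      · have : M.W 0 ω ∈ Iic t := by simp only [mem_Iic, hW0, hc]; simp
        simp [reserve, oneClaimPow, hc, indicator_of_mem this]
    rw [h0]
    simp
  · obtain ⟨n, hn⟩ := Nat.exists_eq_add_of_le' h2
    have hS : M.Z 0 ω ≤ M.claimSum t ω :=
      Finset.single_le_sum (f := fun i => M.Z i ω) (fun i _ => (hZ i).le)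
        (Finset.mem_range.2 (by omega))
    have hb : |M.reserve 0 t ω ^ i - M.oneClaimPow i t ω| ≤
        2 * (i.factorial / R ^ i) * Real.exp (R * (M.c * t)) *
          Real.exp (R * M.claimSum t ω) := by
      have hm : M.W 0 ω ∈ Iic t := hW0.2 (by omega)
      have e1 : M.reserve 0 t ω = M.c * t - M.claimSum t ω := by rw [reserve, zero_add]; rfl
      have e2 : M.oneClaimPow i t ω = (M.c * t - M.Z 0 ω) ^ i := by
        simp [oneClaimPow, indicator_of_mem hm]
      rw [e1, e2]
      have h3 := h.abs_sub_pow_le i hct ((hZ 0).le.trans hS)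
      have h4 := h.abs_sub_pow_le i hct (hZ 0).le
      have h5 : Real.exp (R * (M.c * t + M.Z 0 ω)) ≤
          Real.exp (R * (M.c * t + M.claimSum t ω)) := by gcongr
      have h6 : (i.factorial / R ^ i) * Real.exp (R * (M.c * t + M.Z 0 ω)) ≤
          (i.factorial / R ^ i) * Real.exp (R * (M.c * t + M.claimSum t ω)) := by gcongr
      calc _ ≤ |(M.c * t - M.claimSum t ω) ^ i| + |(M.c * t - M.Z 0 ω) ^ i| := abs_sub _ _
        _ ≤ 2 * ((i.factorial / R ^ i) * Real.exp (R * (M.c * t + M.claimSum t ω))) := by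
            linarith
        _ = _ := by rw [mul_add R, Real.exp_add]; ring
    refine (ENNReal.ofReal_le_ofReal hb).trans ?_
    rw [ENNReal.ofReal_mul (by positivity)]
    refine mul_le_mul_right (le_trans (le_of_eq ?_) (ENNReal.le_tsum n)) _
    rw [← hn, Finset.prod_eq_one, one_mul, claimSum, Finset.mul_sum, Real.exp_sum,
      ENNReal.ofReal_prod_of_nonneg fun l _ => (Real.exp_pos _).le]
    intro l hl
    have := (hω.arrival_le_iff_lt_count t l).2 (Finset.mem_range.1 hl)
    simp [W_le_of_arrival_le hω.1 this le_rfl]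

lemma IsAdjustmentCoeff.lintegral_reserve_pow_sub_le (h : M.IsAdjustmentCoeff R) (i : ℕ) :
    ∃ B t₀ : ℝ, 0 ≤ B ∧ 0 < t₀ ∧ ∀ t, 0 < t → t ≤ t₀ →
      ∫⁻ ω, ENNReal.ofReal |M.reserve 0 t ω ^ i - M.oneClaimPow i t ω| ∂M.P ≤
        ENNReal.ofReal (B * t ^ 2) := by
  have hR := h.1
  have hl := M.lam_pos
  have hc := M.c_pos
  have ha := M.claimRate_pos
  set q : ℝ := 1 + R / M.claimRate with hq
  have hq0 : 0 < q := by positivity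
  -- By independence the term `n` has mean at most `(λ t q)^(n + 2)`. The choice of `t₀` makes the
  -- ratio at most `1 / 2`, so the geometric series is at most `2 (λ t q)²`, and `t ≤ 1` removes `t`
  -- from the exponential.
  refine ⟨2 * (i.factorial / R ^ i) * Real.exp (R * M.c) * (2 * (M.lam * q) ^ 2),
    min 1 (1 / (2 * M.lam * q)), by positivity, by positivity, fun t ht ht0 => ?_⟩
  have ht1 : t ≤ 1 := ht0.trans (min_le_left _ _)
  have ht2 : M.lam * t * q ≤ 1 / 2 := by
    have := ht0.trans (min_le_right _ _)
    rw [le_div_iff₀ (by positivity)] at this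
    linarith
  set x : ℝ≥0∞ := ENNReal.ofReal (M.lam * t * q) with hx
  have hx2 : x ≤ 1 / 2 := by
    rw [hx, ← ENNReal.ofReal_one, ← ENNReal.ofReal_ofNat 2, ← ENNReal.ofReal_div_of_pos two_pos]
    exact ENNReal.ofReal_le_ofReal ht2
  have hp : expMeasure M.lam (Iic t) ≤ ENNReal.ofReal (M.lam * t) := by
    rw [expMeasure_Iic hl ht.le]
    refine ENNReal.ofReal_le_ofReal ?_
    linarith [Real.add_one_le_exp (-(M.lam * t))]
  have hterm : ∀ n : ℕ, ∫⁻ ω, (∏ l ∈ Finset.range (n + 2), (Iic t).indicator 1 (M.W l ω)) *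
      ∏ l ∈ Finset.range (n + 2), ENNReal.ofReal (Real.exp (R * M.Z l ω)) ∂M.P ≤ x ^ (n + 2) := by
    intro n
    rw [M.lintegral_prod_W_mul_prod_Z (f := (Iic t).indicator 1)
      (g := fun z => ENNReal.ofReal (Real.exp (R * z)))
      (measurable_one.indicator measurableSet_Iic) (by fun_prop),
      lintegral_indicator_one measurableSet_Iic, h.lintegral_exp_claim, ← mul_pow, hx,
      ENNReal.ofReal_mul (by positivity)]
    gcongr
  have hgeo : ∑' n : ℕ, x ^ (n + 2) ≤ ENNReal.ofReal (2 * (M.lam * q) ^ 2 * t ^ 2) := by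
    simp_rw [pow_add]
    rw [ENNReal.tsum_mul_right, ENNReal.tsum_geometric]
    have h1 : (1 - x)⁻¹ ≤ ENNReal.ofReal 2 := by
      have h0 : 2⁻¹ ≤ 1 - x := by
        refine ENNReal.le_sub_of_add_le_left ENNReal.ofReal_ne_top ?_
        calc x + 2⁻¹ ≤ 2⁻¹ + 2⁻¹ := by gcongr; simpa using hx2
          _ = 1 := ENNReal.inv_two_add_inv_two
      rw [ENNReal.ofReal_ofNat]
      simpa using ENNReal.inv_le_inv.2 h0
    refine (mul_le_mul_left h1 _).trans (le_of_eq ?_)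
    rw [hx, ← ENNReal.ofReal_pow (by positivity), ← ENNReal.ofReal_mul zero_le_two]
    ring_nf
  calc ∫⁻ ω, ENNReal.ofReal |M.reserve 0 t ω ^ i - M.oneClaimPow i t ω| ∂M.P
      ≤ ∫⁻ ω, ENNReal.ofReal (2 * (i.factorial / R ^ i) * Real.exp (R * (M.c * t))) *
        ∑' n, (∏ l ∈ Finset.range (n + 2), (Iic t).indicator 1 (M.W l ω)) *
          ∏ l ∈ Finset.range (n + 2), ENNReal.ofReal (Real.exp (R * M.Z l ω)) ∂M.P := by
        refine lintegral_mono_ae ?_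
        filter_upwards [M.ae_regularPath, M.ae_Z_pos] with ω hω hZ
        exact hω.abs_reserve_pow_sub_le hZ h i ht.le
    _ ≤ ENNReal.ofReal (2 * (i.factorial / R ^ i) * Real.exp (R * M.c)) *
        ∑' n : ℕ, x ^ (n + 2) := by
        rw [lintegral_const_mul' _ _ ENNReal.ofReal_ne_top, lintegral_tsum]
        · refine mul_le_mul' (ENNReal.ofReal_le_ofReal ?_) (ENNReal.tsum_le_tsum hterm)
          gcongr
          exact mul_le_of_le_one_right hc.le ht1
        · intro n
          refine (Measurable.mul ?_ ?_).aemeasurable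
          · exact Finset.measurable_fun_prod _ fun l _ =>
              (measurable_one.indicator measurableSet_Iic).comp (M.measurable_W l)
          · refine Finset.measurable_fun_prod _ fun l _ => ?_
            have := M.measurable_Z l
            fun_prop
    _ ≤ _ := by
        refine (mul_le_mul_right hgeo _).trans (le_of_eq ?_)
        rw [← ENNReal.ofReal_mul (by positivity)]
        ring_nf

lemma IsAdjustmentCoeff.integrable_sub_pow (h : M.IsAdjustmentCoeff R) (i : ℕ) (s : ℝ) :
    Integrable (fun z => (s - z) ^ i) M.claimLaw := by
  refine ((h.integrable_exp_claim.const_mul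
    (i.factorial / R ^ i * Real.exp (R * |s|)))).mono' (by fun_prop) ?_
  filter_upwards [M.ae_claimLaw_pos] with z hz
  rw [Real.norm_eq_abs, mul_assoc, ← Real.exp_add, ← mul_add, abs_pow]
  refine le_trans ?_ (h.pow_le_exp i (add_nonneg (abs_nonneg s) hz.le))
  refine pow_le_pow_left₀ (abs_nonneg _) ?_ i
  rw [← abs_of_pos hz]
  simpa using abs_sub s |z|

lemma IsAdjustmentCoeff.integrable_oneClaimPow (h : M.IsAdjustmentCoeff R) (i : ℕ) (t : ℝ) :
    Integrable (M.oneClaimPow i t) M.P ∧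
      ∫ ω, M.oneClaimPow i t ω ∂M.P = (M.c * t) ^ i + (expMeasure M.lam).real (Iic t) *
        ((∫ z, (M.c * t - z) ^ i ∂M.claimLaw) - (M.c * t) ^ i) := by
  have hmf : Measurable ((Iic t).indicator (1 : ℝ → ℝ)) :=
    measurable_one.indicator measurableSet_Iic
  have hmg : Measurable fun z : ℝ => (M.c * t - z) ^ i - (M.c * t) ^ i := by fun_prop
  have hi1 : Integrable (fun ω => (Iic t).indicator (1 : ℝ → ℝ) (M.W 0 ω)) M.P := by
    refine Integrable.of_bound (hmf.comp (M.measurable_W 0)).aestronglyMeasurable 1 ?_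
    filter_upwards with ω
    by_cases hω : M.W 0 ω ≤ t <;> simp [hω]
  have hgl : Integrable (fun z : ℝ => (M.c * t - z) ^ i - (M.c * t) ^ i) M.claimLaw :=
    (h.integrable_sub_pow i (M.c * t)).sub (integrable_const _)
  have hi2 : Integrable (fun ω => (M.c * t - M.Z 0 ω) ^ i - (M.c * t) ^ i) M.P :=
    hgl.comp_measurable (M.measurable_Z 0)
  have hind : IndepFun (fun ω => (Iic t).indicator (1 : ℝ → ℝ) (M.W 0 ω))
      (fun ω => (M.c * t - M.Z 0 ω) ^ i - (M.c * t) ^ i) M.P :=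
    (M.indepFun_W_Z 0 0).comp hmf hmg
  have hprod : Integrable (fun ω => (Iic t).indicator (1 : ℝ → ℝ) (M.W 0 ω) *
      ((M.c * t - M.Z 0 ω) ^ i - (M.c * t) ^ i)) M.P := hind.integrable_mul hi1 hi2
  refine ⟨(integrable_const _).add hprod, ?_⟩
  unfold oneClaimPow
  rw [integral_add (integrable_const _) hprod, hind.integral_fun_mul_eq_mul_integral
    hi1.aestronglyMeasurable hi2.aestronglyMeasurable]
  congr 1
  · simp
  · congr 1
    · rw [← integral_map (f := (Iic t).indicator (1 : ℝ → ℝ)) (M.measurable_W 0).aemeasurable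
        hmf.aestronglyMeasurable, M.law_W, integral_indicator_one measurableSet_Iic]
    · rw [← integral_map (f := fun z => (M.c * t - z) ^ i - (M.c * t) ^ i)
        (M.measurable_Z 0).aemeasurable hmg.aestronglyMeasurable]
      change ∫ z, _ ∂M.claimLaw = _
      rw [integral_sub (h.integrable_sub_pow i (M.c * t)) (integrable_const _)]
      simp

/-- The moments of the reserve at small times. -/
lemma IsAdjustmentCoeff.exists_abs_integral_reserve_sub_le (h : M.IsAdjustmentCoeff R) (i : ℕ) :
    ∃ B t₀ : ℝ, 0 ≤ B ∧ 0 < t₀ ∧ ∀ t, 0 < t → t ≤ t₀ →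
      |∫ ω, M.reserve 0 t ω ^ i ∂M.P - ((M.c * t) ^ i + (expMeasure M.lam).real (Iic t) *
        ((∫ z, (M.c * t - z) ^ i ∂M.claimLaw) - (M.c * t) ^ i))| ≤ B * t ^ 2 := by
  obtain ⟨B, t₀, hB, ht₀, hb⟩ := h.lintegral_reserve_pow_sub_le i
  refine ⟨B, t₀, hB, ht₀, fun t ht htt => ?_⟩
  obtain ⟨hi, he⟩ := h.integrable_oneClaimPow i t
  have hd : Integrable (fun ω => M.reserve 0 t ω ^ i - M.oneClaimPow i t ω) M.P := by
    refine ⟨(((M.aemeasurable_reserve 0 t).pow_const i).sub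
      (M.measurable_oneClaimPow i t).aemeasurable).aestronglyMeasurable, ?_⟩
    rw [hasFiniteIntegral_iff_norm]
    exact (hb t ht htt).trans_lt ENNReal.ofReal_lt_top
  have hr : Integrable (fun ω => M.reserve 0 t ω ^ i) M.P := by
    exact (hd.add hi).congr (Eventually.of_forall fun ω => by simp)
  rw [← he, ← integral_sub hr hi, ← Real.norm_eq_abs]
  refine (norm_integral_le_lintegral_norm _).trans ?_
  exact ENNReal.toReal_le_of_le_ofReal (by positivity) (hb t ht htt)

lemma IsAdjustmentCoeff.tendsto_integral_sub_pow (h : M.IsAdjustmentCoeff R) (i : ℕ) :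
    Tendsto (fun t => ∫ z, (M.c * t - z) ^ i ∂M.claimLaw) (𝓝[>] 0)
      (𝓝 ((-1) ^ i * M.moment i)) := by
  have hR := h.1
  have e : (-1) ^ i * M.moment i = ∫ z, (M.c * 0 - z) ^ i ∂M.claimLaw := by
    rw [← integral_claimLaw, ← integral_const_mul]
    refine integral_congr_ae (Eventually.of_forall fun z => ?_)
    dsimp only
    rw [← mul_pow]
    ring
  rw [e]
  refine tendsto_integral_filter_of_dominated_convergence
    (fun z => i.factorial / R ^ i * Real.exp (R * M.c) * Real.exp (R * z)) ?_ ?_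
    (h.integrable_exp_claim.const_mul _) ?_
  · exact Eventually.of_forall fun t => by fun_prop
  · filter_upwards [Ioc_mem_nhdsGT zero_lt_one] with t ht
    filter_upwards [M.ae_claimLaw_pos] with z hz
    have hct : M.c * t ≤ M.c := mul_le_of_le_one_right M.c_pos.le ht.2
    refine (h.abs_sub_pow_le i (mul_nonneg M.c_pos.le ht.1.le) hz.le).trans ?_
    rw [mul_assoc, ← Real.exp_add, ← mul_add]
    gcongr
  · refine Eventually.of_forall fun z => ?_
    have : Continuous fun t => (M.c * t - z) ^ i := by fun_prop
    exact (this.tendsto 0).mono_left nhdsWithin_le_nhds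

lemma tendsto_expMeasure_div {r : ℝ} (hr : 0 < r) :
    Tendsto (fun t => (expMeasure r).real (Iic t) / t) (𝓝[>] 0) (𝓝 r) := by
  have hd : HasDerivAt (fun t => 1 - Real.exp (-(r * t))) r 0 := by
    have h1 : HasDerivAt (fun t => -(r * t)) (-r) 0 := by
      simpa using ((hasDerivAt_id' (0 : ℝ)).const_mul r).fun_neg
    simpa using h1.exp.const_sub 1
  have ht := hd.tendsto_slope.mono_left (nhdsWithin_mono (0 : ℝ) fun x (hx : 0 < x) => hx.ne')
  refine ht.congr' ?_
  filter_upwards [self_mem_nhdsWithin] with t ht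
  rw [Measure.real, expMeasure_Iic hr (le_of_lt ht), ENNReal.toReal_ofReal, slope_def_field]
  · simp
  · have := mul_pos hr ht
    simp only [sub_nonneg, Real.exp_le_one_iff]
    linarith

/-- The derivatives at time `0` of the moments of the reserve. -/
theorem IsAdjustmentCoeff.tendsto_integral_reserve_pow_div (h : M.IsAdjustmentCoeff R) {i : ℕ}
    (hi : 1 ≤ i) :
    Tendsto (fun t => (∫ ω, M.reserve 0 t ω ^ i ∂M.P) / t) (𝓝[>] 0)
      (𝓝 ((if i = 1 then M.c else 0) + M.lam * ((-1) ^ i * M.moment i))) := by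
  obtain ⟨B, t₀, hB, ht₀, hb⟩ := h.exists_abs_integral_reserve_sub_le i
  set main : ℝ → ℝ := fun t => (M.c * t) ^ i + (expMeasure M.lam).real (Iic t) *
        ((∫ z, (M.c * t - z) ^ i ∂M.claimLaw) - (M.c * t) ^ i) with hmain
  have hct : Tendsto (fun t => (M.c * t) ^ i) (𝓝[>] 0) (𝓝 0) := by
    have hc : Continuous fun t => (M.c * t) ^ i := by fun_prop
    have := (hc.tendsto 0).mono_left (nhdsWithin_le_nhds (s := Ioi 0))
    rwa [mul_zero, zero_pow (by omega)] at this
  have h1 : Tendsto (fun t => (M.c * t) ^ i / t) (𝓝[>] 0) (𝓝 (if i = 1 then M.c else 0)) := by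
    have hc : Continuous fun t => M.c ^ i * t ^ (i - 1) := by fun_prop
    have h2 := (hc.tendsto 0).mono_left (nhdsWithin_le_nhds (s := Ioi 0))
    have e : M.c ^ i * 0 ^ (i - 1) = if i = 1 then M.c else 0 := by
      rcases eq_or_ne i 1 with rfl | hne
      · simp
      · rw [if_neg hne, zero_pow (by omega), mul_zero]
    rw [e] at h2
    refine h2.congr' ?_
    filter_upwards [self_mem_nhdsWithin] with t ht
    have ht : (0 : ℝ) < t := ht
    obtain ⟨l, rfl⟩ := Nat.exists_eq_add_of_le' hi
    rw [Nat.add_sub_cancel, mul_pow, pow_succ t]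
    field_simp
  have h2 : Tendsto (fun t => main t / t) (𝓝[>] 0)
      (𝓝 ((if i = 1 then M.c else 0) + M.lam * ((-1) ^ i * M.moment i))) := by
    have := h1.add ((tendsto_expMeasure_div M.lam_pos).mul
      ((h.tendsto_integral_sub_pow i).sub hct))
    rw [sub_zero] at this
    refine this.congr fun t => ?_
    simp only [hmain]
    ring
  have h3 : Tendsto (fun t => (∫ ω, M.reserve 0 t ω ^ i ∂M.P) / t - main t / t) (𝓝[>] 0)
      (𝓝 0) := by
    have hBt : Tendsto (fun t => B * t) (𝓝[>] 0) (𝓝 0) := by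
      have hc : Continuous fun t => B * t := by fun_prop
      have := (hc.tendsto 0).mono_left (nhdsWithin_le_nhds (s := Ioi 0))
      simpa using this
    refine squeeze_zero_norm' ?_ hBt
    filter_upwards [Ioc_mem_nhdsGT ht₀] with t ht
    rw [← sub_div, norm_div, Real.norm_eq_abs, Real.norm_of_nonneg ht.1.le, div_le_iff₀ ht.1]
    refine (hb t ht.1 ht.2).trans (le_of_eq ?_)
    ring
  simpa using h3.add h2

/-- A De Vylder type approximation matches the cumulants of the reserve per unit of time. -/
theorem IsDeVylder.cumulant_eq {D : RiskModel.{w}} {R' : ℝ} {k : ℕ} (hD : IsDeVylder k M D)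
    (h : M.IsAdjustmentCoeff R) (h' : D.IsAdjustmentCoeff R') {i : ℕ} (hi : 1 ≤ i)
    (hik : i ≤ k) :
    (if i = 1 then M.c else 0) + M.lam * ((-1) ^ i * M.moment i) =
      (if i = 1 then D.c else 0) + D.lam * ((-1) ^ i * D.moment i) := by
  refine tendsto_nhds_unique (h.tendsto_integral_reserve_pow_div hi)
    ((h'.tendsto_integral_reserve_pow_div hi).congr' ?_)
  filter_upwards [self_mem_nhdsWithin] with t ht
  rw [hD i hi hik t (le_of_lt ht) 0 le_rfl]

lemma IsDeVylder.drift_eq {D : RiskModel.{w}} {R' : ℝ} {k : ℕ} (hD : IsDeVylder k M D)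
    (h : M.IsAdjustmentCoeff R) (h' : D.IsAdjustmentCoeff R') (hk : 1 ≤ k) :
    M.c - M.lam * M.moment 1 = D.c - D.lam * D.moment 1 := by
  have := hD.cumulant_eq h h' le_rfl hk
  simp only [if_true, pow_one] at this
  linarith

lemma IsDeVylder.lam_mul_moment_eq {D : RiskModel.{w}} {R' : ℝ} {k : ℕ} (hD : IsDeVylder k M D)
    (h : M.IsAdjustmentCoeff R) (h' : D.IsAdjustmentCoeff R') {i : ℕ} (hi : 2 ≤ i) (hik : i ≤ k) :
    M.lam * M.moment i = D.lam * D.moment i := by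
  have := hD.cumulant_eq h h' (by omega) hik
  rw [if_neg (by omega), if_neg (by omega), zero_add, zero_add, mul_left_comm,
    mul_left_comm D.lam] at this
  exact mul_left_cancel₀ (pow_ne_zero i (by norm_num)) this

end

end RiskModel

/-! ### Uniform bounds for the conditional moments and the errors -/

namespace RiskModel

noncomputable section

variable {M : RiskModel.{v}} {R : ℝ}

/-- The conditional moments of the deficit at ruin are bounded above and below, uniformly in the
model and in the initial reserve. -/
theorem exists_deficitMoment_bounds {j k : ℕ} (hk : 2 ≤ k) (hj : j + 1 ≤ k) {m₁ : ℝ}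
    (hm₁ : 0 < m₁) {A : ℝ} (hA : 0 < A) (K H : ℝ≥0) :
    ∃ b B : ℝ, 0 < b ∧ 0 < B ∧ ∀ (M : RiskModel.{v}) (R : ℝ), M.IsAdjustmentCoeff R →
      M.moment 1 = m₁ → 1 / M.claimRate ≤ A → M.expMoment k R ≤ K → M.hazardSup ≤ H →
      ∀ u, 0 ≤ u → 0 < M.P (M.ruin u) ∧
        Integrable (fun ω => M.deficit u ω ^ j) (ProbabilityTheory.cond M.P (M.ruin u)) ∧
        b ≤ M.deficitMoment j u ∧ M.deficitMoment j u ≤ B := by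
  obtain ⟨b, B, hb, hB, hj'⟩ := exists_tiltedRuinMoment_bounds.{v} hk hj hm₁ hA K H
  obtain ⟨b₀, B₀, hb₀, hB₀, h0'⟩ :=
    exists_tiltedRuinMoment_bounds.{v} (j := 0) hk (by omega) hm₁ hA K H
  refine ⟨b / B₀, B / b₀, by positivity, by positivity, fun M R h hM hrate hK hH u hu => ?_⟩
  obtain ⟨h1, h2⟩ := hj' M R h hM hrate hK hH u hu
  obtain ⟨h3, h4⟩ := h0' M R h hM hrate hK hH u hu
  -- The tilting factor `e^{Ru}` cancels, so bounds uniform in `u` pass to the ratio.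
  have he : M.ruinMoment j u / M.ruinMoment 0 u =
      M.tiltedRuinMoment R j u / M.tiltedRuinMoment R 0 u :=
    (ENNReal.mul_div_mul_left _ _ (ENNReal.ofReal_pos.2 (Real.exp_pos _)).ne'
      ENNReal.ofReal_ne_top).symm
  have hupper : M.ruinMoment j u / M.ruinMoment 0 u ≤ ENNReal.ofReal (B / b₀) := by
    rw [he, ENNReal.ofReal_div_of_pos hb₀]
    exact ENNReal.div_le_div h2 h3
  have hlower : ENNReal.ofReal (b / B₀) ≤ M.ruinMoment j u / M.ruinMoment 0 u := by
    rw [he, ENNReal.ofReal_div_of_pos hB₀]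
    exact ENNReal.div_le_div h1 h4
  have hne : M.ruinMoment j u / M.ruinMoment 0 u ≠ ∞ :=
    ne_top_of_le_ne_top ENNReal.ofReal_ne_top hupper
  refine ⟨?_, M.integrable_deficit_pow hu j hne, ?_, ?_⟩
  · rw [M.measure_ruin hu, pos_iff_ne_zero]
    intro h0
    rw [tiltedRuinMoment, h0, mul_zero] at h3
    exact absurd (ENNReal.ofReal_pos.2 hb₀) (not_lt.2 h3)
  · rw [M.deficitMoment_eq hu]
    exact (ENNReal.ofReal_le_iff_le_toReal hne).1 hlower
  · rw [M.deficitMoment_eq hu]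
    exact ENNReal.toReal_le_of_le_ofReal (by positivity) hupper

lemma one_div_claimRate_eq (h : M.IsAdjustmentCoeff R) :
    1 / M.claimRate = M.moment 1 + M.moment 1 * M.loading := by
  have h1 := M.lam_pos.ne'
  have h2 := M.c_pos.ne'
  have h3 := h.moment_one_pos.ne'
  rw [claimRate, loading]
  field_simp
  ring

/-- The claim rate of a De Vylder type approximation. -/
lemma IsDeVylder.one_div_claimRate_eq {D : RiskModel.{w}} {R' : ℝ} {k : ℕ}
    (hD : IsDeVylder k M D) (h : M.IsAdjustmentCoeff R) (h' : D.IsAdjustmentCoeff R')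
    (hk : 2 ≤ k) :
    1 / D.claimRate =
      D.moment 1 + D.moment 2 / M.moment 2 * (M.moment 1 * M.loading) := by
  have e1 := hD.drift_eq h h' (by omega)
  have e2 := hD.lam_mul_moment_eq h h' le_rfl hk
  have h1 := M.lam_pos.ne'
  have h2 := D.lam_pos.ne'
  have h3 := h.moment_one_pos.ne'
  have h4 := (h.moment_pos 2).ne'
  -- Matching at order 2 gives the ratio of the intensities; this turns the common drift into a
  -- formula for `1 / D.claimRate` that is affine in the loading.
  have e3 : D.moment 2 / M.moment 2 = M.lam / D.lam := by
    rw [div_eq_div_iff h4 h2]; linarith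
  have e4 : M.moment 1 * M.loading = (M.c - M.lam * M.moment 1) / M.lam := by
    rw [loading]; field_simp
  rw [e3, e4, e1, claimRate, one_div_div]
  field_simp
  ring

/-- No cancellation between the two models is used: both conditional moments lie in fixed bounded
intervals, and the lower end `b` of the first one bounds the relative error. -/
theorem exists_deficitErrorLe (k j : ℕ) (hk : 2 ≤ k) (hjk : j + 1 ≤ k) (θmax : ℝ)
    (m mDV : ℕ → ℝ) (K H : ℝ≥0) : ∃ C : ℝ,
      ∀ (M : RiskModel.{v}) (D : RiskModel.{w}) (R RDV : ℝ),
        M.Assumptions k R → D.Assumptions k RDV → RiskModel.IsDeVylder k M D →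
        M.loading ≤ θmax →
        (∀ i, 1 ≤ i → i ≤ k → M.moment i = m i ∧ D.moment i = mDV i) →
        M.expMoment k R ≤ K → D.expMoment k RDV ≤ K →
        M.hazardSup ≤ H → D.hazardSup ≤ H →
        ∀ u : ℝ, 0 ≤ u → RiskModel.DeficitErrorLe M D j u C := by
  -- If a prescribed first moment is not positive, no pair of models qualifies and any constant
  -- works.
  by_cases hm : 0 < m 1 ∧ 0 < mDV 1
  · obtain ⟨b, B, hb, hB, hM⟩ := exists_deficitMoment_bounds.{v} hk hjk hm.1
      (lt_max_of_lt_left one_pos : 0 < max 1 (m 1 + m 1 * θmax)) K H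
    obtain ⟨b', B', hb', hB', hD⟩ := exists_deficitMoment_bounds.{w} hk hjk hm.2
      (lt_max_of_lt_left one_pos : 0 < max 1 (mDV 1 + mDV 2 / m 2 * (m 1 * θmax))) K H
    refine ⟨max (B + B') ((B + B') / b), fun M D R RDV hAM hAD hMD hθ hmom hKM hKD hHM hHD u hu => ?_⟩
    have hM1 := (hmom 1 le_rfl (by omega)).1
    have hD1 := (hmom 1 le_rfl (by omega)).2
    have hM2 := (hmom 2 one_le_two hk).1
    have hD2 := (hmom 2 one_le_two hk).2
    have hrM : 1 / M.claimRate ≤ max 1 (m 1 + m 1 * θmax) := by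
      rw [RiskModel.one_div_claimRate_eq hAM.lundberg, hM1]
      exact le_max_of_le_right (by nlinarith [hm.1])
    have hrD : 1 / D.claimRate ≤ max 1 (mDV 1 + mDV 2 / m 2 * (m 1 * θmax)) := by
      rw [hMD.one_div_claimRate_eq hAM.lundberg hAD.lundberg hk, hM1, hD1, hM2, hD2]
      refine le_max_of_le_right ?_
      have h1 : 0 < m 2 := hM2 ▸ hAM.lundberg.moment_pos 2
      have h2 : 0 < mDV 2 := hD2 ▸ hAD.lundberg.moment_pos 2
      have h3 := hm.1
      gcongr
    obtain ⟨h1, h2, h3, h4⟩ := hM M R hAM.lundberg hM1 hrM hKM hHM u hu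
    obtain ⟨h1', h2', h3', h4'⟩ := hD D RDV hAD.lundberg hD1 hrD hKD hHD u hu
    have hd : 0 < M.deficitMoment j u := hb.trans_le h3
    have habs : |M.deficitMoment j u - D.deficitMoment j u| ≤ B + B' :=
      abs_le.2 ⟨by linarith, by linarith⟩
    refine ⟨h1, h1', h2, h2', hd, habs.trans (le_max_left _ _), ?_⟩
    rw [abs_div, abs_of_pos hd]
    refine le_max_of_le_right ?_
    gcongr
  · refine ⟨0, fun M D R RDV hAM hAD _ _ hmom => absurd ⟨?_, ?_⟩ hm⟩
    · exact (hmom 1 le_rfl (by omega)).1 ▸ hAM.lundberg.moment_one_pos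
    · exact (hmom 1 le_rfl (by omega)).2 ▸ hAD.lundberg.moment_one_pos

/-! ### Models with the same claim law -/

lemma moment_congr {M' : RiskModel.{w}} (hF : M.claimLaw = M'.claimLaw) (i : ℕ) :
    M.moment i = M'.moment i := by
  rw [← integral_claimLaw, ← integral_claimLaw, hF]

lemma survival_congr {M' : RiskModel.{w}} (hF : M.claimLaw = M'.claimLaw) (x : ℝ) :
    M.survival x = M'.survival x := by
  have h1 := M.claimLaw_Ioi x
  rw [hF, M'.claimLaw_Ioi] at h1
  exact ((ENNReal.ofReal_eq_ofReal_iff (M'.survival_nonneg x) (M.survival_nonneg x)).1 h1).symm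

lemma hazardSup_congr {M' : RiskModel.{w}} (hF : M.claimLaw = M'.claimLaw) :
    M.hazardSup = M'.hazardSup := by
  simp only [hazardSup, tailDensity, tailSurvival, survival_congr hF, moment_congr hF]

/-- The adjustment coefficient decreases with the claim rate. -/
lemma IsAdjustmentCoeff.le_of_claimRate_lt {M' : RiskModel.{w}} {R' : ℝ}
    (h : M.IsAdjustmentCoeff R) (h' : M'.IsAdjustmentCoeff R') (hF : M.claimLaw = M'.claimLaw)
    (hlt : M'.claimRate < M.claimRate) : R ≤ R' := by
  by_contra hn
  have hR : R' ≤ R := (not_le.1 hn).le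
  have ha' := M'.claimRate_pos
  -- With a larger exponent, the tilted density of `M` is at least `M.claimRate / M'.claimRate`
  -- times that of `M'`. Both have mass 1, so this ratio is at most 1.
  have h1 : ENNReal.ofReal (M.claimRate / M'.claimRate) ≤ 1 := by
    rw [← mul_one (ENNReal.ofReal _), ← h'.lintegral_tiltedDensity,
      ← lintegral_const_mul' _ _ ENNReal.ofReal_ne_top, h'.lintegral_tiltedDensity,
      ← h.lintegral_tiltedDensity]
    refine setLIntegral_mono (M.measurable_tiltedDensity R) fun x hx => ?_
    have hx0 : (0 : ℝ) ≤ x := le_of_lt hx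
    have ha := M.claimRate_pos
    rw [tiltedDensity, tiltedDensity, hF, ← mul_assoc, ← ENNReal.ofReal_mul (by positivity)]
    refine mul_le_mul_left (ENNReal.ofReal_le_ofReal ?_) _
    rw [← mul_assoc, div_mul_cancel₀ _ ha'.ne']
    gcongr
  rw [← ENNReal.ofReal_one, ENNReal.ofReal_le_ofReal_iff zero_le_one, div_le_one ha'] at h1
  exact absurd hlt (not_lt.2 h1)

/-- Compare integrands: `e^{Rx} ≤ e^{R'x}`, and the claim rate of `M` is at most `1 / m_1`, whatever
its loading. -/
lemma IsAdjustmentCoeff.expMoment_le {M' : RiskModel.{w}} {R' : ℝ}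
    (h : M.IsAdjustmentCoeff R) (h' : M'.IsAdjustmentCoeff R') (hF : M.claimLaw = M'.claimLaw)
    (hle : R ≤ R') (k : ℕ) :
    M.expMoment k R ≤
      ENNReal.ofReal (1 / (M'.moment 1 * M'.claimRate)) * M'.expMoment k R' := by
  have ha := M.claimRate_pos
  have ha' := M'.claimRate_pos
  have hm := h'.moment_one_pos
  rw [expMoment_eq h.moment_one_pos, expMoment_eq hm,
    ← lintegral_const_mul' _ _ ENNReal.ofReal_ne_top]
  refine setLIntegral_mono (Measurable.const_mul
    (Measurable.mul (by fun_prop) (M'.measurable_tiltedDensity R')) _) fun x hx => ?_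
  have hx0 : (0 : ℝ) ≤ x := le_of_lt hx
  have hr := h.claimRate_le
  rw [moment_congr hF] at hr
  rw [mul_left_comm, tiltedDensity, tiltedDensity, hF, ← mul_assoc (ENNReal.ofReal (1 / _)),
    ← ENNReal.ofReal_mul (by positivity)]
  have e : M.claimRate * Real.exp (R * x) ≤
      1 / (M'.moment 1 * M'.claimRate) * (M'.claimRate * Real.exp (R' * x)) := by
    calc M.claimRate * Real.exp (R * x) ≤ 1 / M'.moment 1 * Real.exp (R' * x) := by gcongr
      _ = _ := by field_simp
  exact mul_le_mul_right (mul_le_mul_left (ENNReal.ofReal_le_ofReal e) _) _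

theorem exists_deficitErrorLe_of_claimLaw (k j : ℕ) (hk : 2 ≤ k) (hjk : j + 1 ≤ k)
    (θmax : ℝ) (M : ℝ → RiskModel.{v}) (D : ℝ → RiskModel.{w}) (R RDV : ℝ → ℝ)
    (F FDV : Measure ℝ)
    (hyp : ∀ θ ∈ Ioc 0 θmax,
      (M θ).loading = θ ∧ (M θ).claimLaw = F ∧ (D θ).claimLaw = FDV ∧
      (M θ).Assumptions k (R θ) ∧ (D θ).Assumptions k (RDV θ) ∧
      RiskModel.IsDeVylder k (M θ) (D θ)) :
    ∃ C : ℝ, ∀ θ ∈ Ioc 0 θmax, ∀ u : ℝ, 0 ≤ u →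
      RiskModel.DeficitErrorLe (M θ) (D θ) j u C := by
  rcases le_or_gt θmax 0 with h0 | h0
  · exact ⟨0, fun θ hθ => absurd hθ.2 (not_le.2 (h0.trans_lt hθ.1))⟩
  have hmax := hyp θmax ⟨h0, le_rfl⟩
  obtain ⟨hload, hF, hFDV, hAM, hAD, hMD⟩ := hmax
  -- The models at `θmax` have the largest adjustment coefficients, so they supply bounds on the
  -- tilted moments for all smaller `θ`; the hazard suprema depend only on the claim laws.
  set KM : ℝ≥0∞ := ENNReal.ofReal (1 / ((M θmax).moment 1 * (M θmax).claimRate)) *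
    (M θmax).expMoment k (R θmax) with hKM
  set KD : ℝ≥0∞ := ENNReal.ofReal (1 / ((D θmax).moment 1 * (D θmax).claimRate)) *
    (D θmax).expMoment k (RDV θmax) with hKD
  have hKMt : KM ≠ ∞ := ENNReal.mul_ne_top ENNReal.ofReal_ne_top hAM.expMoment_lt_top.ne
  have hKDt : KD ≠ ∞ := ENNReal.mul_ne_top ENNReal.ofReal_ne_top hAD.expMoment_lt_top.ne
  obtain ⟨C, hC⟩ := exists_deficitErrorLe.{v, w} k j hk hjk θmax (M θmax).moment (D θmax).moment
    (max KM KD).toNNReal (max (M θmax).hazardSup (D θmax).hazardSup).toNNReal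
  refine ⟨C, fun θ hθ u hu => ?_⟩
  obtain ⟨hload', hF', hFDV', hAM', hAD', hMD'⟩ := hyp θ hθ
  have eM : (M θ).claimLaw = (M θmax).claimLaw := hF'.trans hF.symm
  have eD : (D θ).claimLaw = (D θmax).claimLaw := hFDV'.trans hFDV.symm
  have hm1 := hAM.lundberg.moment_one_pos
  have hm2 := hAM.lundberg.moment_pos 2
  have hmD2 := hAD.lundberg.moment_pos 2
  -- In both families the inverse claim rate is affine and strictly increasing in `θ`, so a smaller
  -- loading means a larger claim rate and an adjustment coefficient that is no larger.
  have hRle : R θ ≤ R θmax ∧ RDV θ ≤ RDV θmax := by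
    rcases eq_or_lt_of_le hθ.2 with heq | hlt
    · rw [heq]; exact ⟨le_rfl, le_rfl⟩
    · constructor
      · refine hAM'.lundberg.le_of_claimRate_lt hAM.lundberg eM ?_
        rw [← one_div_lt_one_div (M θ).claimRate_pos (M θmax).claimRate_pos,
          one_div_claimRate_eq hAM'.lundberg, one_div_claimRate_eq hAM.lundberg, hload, hload',
          moment_congr eM]
        gcongr
      · refine hAD'.lundberg.le_of_claimRate_lt hAD.lundberg eD ?_
        rw [← one_div_lt_one_div (D θ).claimRate_pos (D θmax).claimRate_pos,
          hMD'.one_div_claimRate_eq hAM'.lundberg hAD'.lundberg hk,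
          hMD.one_div_claimRate_eq hAM.lundberg hAD.lundberg hk, hload, hload',
          moment_congr eM, moment_congr eM, moment_congr eD, moment_congr eD]
        gcongr
  refine hC (M θ) (D θ) (R θ) (RDV θ) hAM' hAD' hMD' (hload'.le.trans hθ.2)
    (fun i _ _ => ⟨moment_congr eM i, moment_congr eD i⟩) ?_ ?_ ?_ ?_ u hu
  · rw [ENNReal.coe_toNNReal (max_lt hKMt.lt_top hKDt.lt_top).ne]
    exact le_max_of_le_left (hAM'.lundberg.expMoment_le hAM.lundberg eM hRle.1 k)
  · rw [ENNReal.coe_toNNReal (max_lt hKMt.lt_top hKDt.lt_top).ne]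
    exact le_max_of_le_right (hAD'.lundberg.expMoment_le hAD.lundberg eD hRle.2 k)
  · rw [ENNReal.coe_toNNReal (max_lt hAM.hazardSup_lt_top hAD.hazardSup_lt_top).ne]
    exact le_max_of_le_left (hazardSup_congr eM).le
  · rw [ENNReal.coe_toNNReal (max_lt hAM.hazardSup_lt_top hAD.hazardSup_lt_top).ne]
    exact le_max_of_le_right (hazardSup_congr eD).le

/-- The conditional moments of the deficit without initial reserve. -/
lemma IsAdjustmentCoeff.deficitMoment_zero (h : M.IsAdjustmentCoeff R) (j : ℕ) :
    M.deficitMoment j 0 = M.moment (j + 1) / ((j + 1) * M.moment 1) := by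
  have ha := M.claimRate_pos
  have h1 := h.moment_pos 1
  have h2 := h.moment_pos (j + 1)
  rw [M.deficitMoment_eq le_rfl, h.ruinMoment_zero, h.ruinMoment_zero, zero_add,
    ← ENNReal.ofReal_div_of_pos (by positivity), ENNReal.toReal_ofReal (by positivity)]
  push_cast
  field_simp
  ring

end

end RiskModel

/-! ### The theorem -/

theorem theorem3 (k j : ℕ) (hk : 2 ≤ k) (hj : 1 ≤ j) (hjk : j ≤ k - 1) :
    -- the constant depends only on bounds on `θ`, `h_I`, `m_k^exp` and on the claim moments
    (∀ (θmax : ℝ) (m mDV : ℕ → ℝ) (K H : ℝ≥0), ∃ C : ℝ,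
      ∀ (M : RiskModel.{v}) (D : RiskModel.{w}) (R RDV : ℝ),
        M.Assumptions k R → D.Assumptions k RDV → RiskModel.IsDeVylder k M D →
        M.loading ≤ θmax →
        (∀ i, 1 ≤ i → i ≤ k → M.moment i = m i ∧ D.moment i = mDV i) →
        M.expMoment k R ≤ K → D.expMoment k RDV ≤ K →
        M.hazardSup ≤ H → D.hazardSup ≤ H →
        ∀ u : ℝ, 0 ≤ u → RiskModel.DeficitErrorLe M D j u C) ∧
    -- for fixed claim laws, the bounds are uniform for `θ` in a bounded interval
    (∀ (θmax : ℝ) (M : ℝ → RiskModel.{v}) (D : ℝ → RiskModel.{w}) (R RDV : ℝ → ℝ)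
        (F FDV : Measure ℝ),
        (∀ θ ∈ Ioc 0 θmax,
          (M θ).loading = θ ∧ (M θ).claimLaw = F ∧ (D θ).claimLaw = FDV ∧
          (M θ).Assumptions k (R θ) ∧ (D θ).Assumptions k (RDV θ) ∧
          RiskModel.IsDeVylder k (M θ) (D θ)) →
        ∃ C : ℝ, ∀ θ ∈ Ioc 0 θmax, ∀ u : ℝ, 0 ≤ u →
          RiskModel.DeficitErrorLe (M θ) (D θ) j u C) ∧
    -- optimality at `u = 0`: the relative error there is a constant independent of `θ`
    (∀ (M : RiskModel.{v}) (D : RiskModel.{w}) (R RDV : ℝ),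
        M.Assumptions k R → D.Assumptions k RDV → RiskModel.IsDeVylder k M D →
        M.deficitMoment j 0 = M.moment (j + 1) / ((j + 1) * M.moment 1) ∧
        D.deficitMoment j 0 = D.moment (j + 1) / ((j + 1) * D.moment 1) ∧
        (M.deficitMoment j 0 - D.deficitMoment j 0) / M.deficitMoment j 0 =
          1 - (M.moment 1 * D.moment 2) / (M.moment 2 * D.moment 1)) := by
  have hjk' : j + 1 ≤ k := by omega
  refine ⟨RiskModel.exists_deficitErrorLe k j hk hjk',
    RiskModel.exists_deficitErrorLe_of_claimLaw k j hk hjk', ?_⟩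
  intro M D R RDV hM hD hMD
  have h := hM.lundberg
  have h' := hD.lundberg
  refine ⟨h.deficitMoment_zero j, h'.deficitMoment_zero j, ?_⟩
  have e1 := hMD.lam_mul_moment_eq h h' (by omega : 2 ≤ j + 1) hjk'
  have e2 := hMD.lam_mul_moment_eq h h' le_rfl hk
  have hlM := M.lam_pos.ne'
  have hlD := D.lam_pos.ne'
  have hM1 := (h.moment_pos 1).ne'
  have hM2 := (h.moment_pos 2).ne'
  have hMj := (h.moment_pos (j + 1)).ne'
  have hD1 := (h'.moment_pos 1).ne'
  have hj0 : (j : ℝ) + 1 ≠ 0 := by positivity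
  -- Moments of orders `j + 1` and 2 are both scaled by the same factor `λ / λ^DV`. The quotient of
  -- the deficit moments therefore does not depend on `j` and can be written with second moments.
  have q1 : D.moment (j + 1) = M.lam * M.moment (j + 1) / D.lam := by
    rw [e1]; field_simp
  have q2 : D.moment 2 = M.lam * M.moment 2 / D.lam := by rw [e2]; field_simp
  rw [h.deficitMoment_zero, h'.deficitMoment_zero, q1, q2]
  field_simp
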